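/- **Setting.** Vectors have $n=1500$ entries; bytes are the alphabet, $*$ is the wildcard. Let $F_0$ be a function family with values in $\{0,1\}^\lambda$ and $\mathsf{Sym}$ a symmetric encryption scheme with uniform keys in $\{0,1\}^\lambda$, messages in $\{0,1\}^\lambda$ and ciphertexts of polynomial length. In SHVE and SHVE+, $msk$ is uniform in $\{0,1\}^\lambda$; $\mathsf{Enc}(msk,\mathbf x)=(F_0(msk,x_l\|l))_{l\le n}$; a SHVE+ trapdoor for $(\mathbf v,m)$ is $(d_0,d_1,S)$, where $S=\{l: v_l\ne *\}$, $K$ is uniform in $\{0,1\}^\lambda$, $d_0=K\oplus\bigoplus_{l\in S}F_0(msk,v_l\|l)$ and $d_1=\mathsf{Sym.Enc}(K,m)$; a SHVE trapdoor is the same with $m=0^\lambda$. **Security notion.** In the real experiment a probabilistic polynomial-time adversary first picks a vector (packet), gets its encryption, then adaptively makes queries, which are answered under the same $msk$, and outputs a bit. In the ideal experiment all replies come from a stateful simulator that gets only $1^\lambda$ (and the ciphertext length of $\mathsf{Sym}$) and, for each query, its leakage. Security means: there is a polynomial-time simulator such that for every probabilistic polynomial-time adversary the probabilities of output $1$ in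 the two experiments differ negligibly in $\lambda$. *Selective simulation security* of SHVE is this notion for trapdoor queries $\mathbf v$ with leakage $\alpha(\mathbf v)=S$ and $\beta(\mathbf v,\mathbf x)$, the truth value of "$\mathbf v$ matches $\mathbf x$"; for SHVE+ the queries are $(\mathbf v,m)$ and the leakage is $\alpha(\mathbf v)$ and $\beta'(\mathbf v,\mathbf x)$, which is $m$ if $\mathbf v$ matches $\mathbf x$, and otherwise a fresh uniform $\lambda$-bit string. **Protocol $\mathcal P$.** A packet is a vector of $n$ bytes. A rule $r$ consists of a non-empty string of at most $n$ bytes, an offset and a depth in $\{0,\dots,n\}$, and an action in $\{0,1\}^\lambda$. Put $start=$ offset if offset $>0$, else $1$, and $end=\min(start+\text{depth},n)$ if depth $>0$, else $n$. The *range* of $r$ consists of all $i$ with $start\le i\le end-len+1$, where $len$ is the length of the string. The encrypted patterns of $r$ are, for all $i$ in the range, SHVE+ trapdoors for the string placed at position $i$ (wildcards elsewhere) with the action as message. The encrypted filter of $r$ holds, for all $i$ in the range, a first-level SHVE trapdoor for bytes $1,2$ of the string placed at $i$ (stored in $\mathcal F_1$ if $len\le 3$, in $\mathcal F_2$ if $len>3$)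 and, if $len>3$, a second-level SHVE trapdoor for bytes $3,4$ placed at $i+2$ (stored in $\mathcal F_3$). (If $len=1$, the first-level entry uses the single byte.) All algorithms use the same $msk$. Filtering and matching are done by the middlebox, without a key, from the encrypted packet and these trapdoors. **Theorem.** If SHVE+ and SHVE are selectively simulation-secure, then $\mathcal P$ is $\mathcal L_1$-secure in the above sense against adversaries that pick a packet $P$, get its encryption, and then adaptively query rules $r$, getting for each the encrypted patterns and the encrypted filter of $r$. Here nothing is leaked with the encrypted packet, and $\mathcal L_1$ consists, for each queried rule $r$, of the shape $(len,start,end)$ of the rule, the possible matching positions $\mathsf{Pos_f}$ (the positions $i$ in the range at which the first-level filter entry matches $P$, and those at which the second-level filter entry matches $P$), the matched positions $\mathsf{Pos_e}$ (the $i$ in the range at which the whole string occurs in $P$), and $\mathsf{Act}$ (the action of $r$ if $\mathsf{Pos_e}\ne\emptyset$, else $\bot$). -/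

import Mathlib

namespace PatternMatching

noncomputable section

/-! ## Bit strings -/

/-- Bit strings of length `k`. -/
abbrev Bits (k : ℕ) : Type := Fin k → Bool

/-- Bytes. -/
abbrev Byte : Type := Bits 8

/-- The bits `s[off], …, s[off + k - 1]`; missing bits are read as `false`. -/
def readBits (k off : ℕ) (s : List Bool) : Bits k := fun i => s.getD (off + i) false

/-- A number `≤ k` sits in a field of `k` bits as the number of its ones. -/
def readNat (k off : ℕ) (s : List Bool) : ℕ := (List.ofFn (readBits k off s)).count true

/-- Write a number `≤ k` into a field of `k` bits. -/
def writeNat (k a : ℕ) : List Bool := List.ofFn fun i : Fin k => decide (i.val < a)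

/-- Cut or pad (with `false`) a string to length `n`. -/
def fit (n : ℕ) (s : List Bool) : List Bool := s.takeD n false

/-! ## Probabilistic oracle programs with a step count

The machine has registers `0, 1, 2, …`, each holding a bit string (used as a queue); a program
mentions finitely many of them. Every elementary instruction, test, and oracle call costs one
step. Up to polynomial overhead this is the probabilistic multitape Turing machine with an
oracle tape. -/

/-- Programs. -/
inductive Prog : Type
  /-- do nothing -/
  | skip : Prog
  /-- append the bit `b` at the back of register `r` -/
  | push (r : ℕ) (b : Bool) : Prog
  /-- delete the front bit of register `r`, if there is one -/
  | pop (r : ℕ) : Prog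
  /-- append a fresh uniform bit at the back of register `r` -/
  | flip (r : ℕ) : Prog
  /-- sequential composition -/
  | seq (p q : Prog) : Prog
  /-- run `p` if the front bit of register `r` is `true`, else (`false`, or `r` empty) run `q` -/
  | ite (r : ℕ) (p q : Prog) : Prog
  /-- repeat `p` as long as register `r` is non-empty -/
  | loop (r : ℕ) (p : Prog) : Prog
  /-- send register `0` to the oracle and replace it by the reply -/
  | call : Prog

/-- Register contents. -/
abbrev Regs : Type := ℕ → List Bool

/-- Probabilistic oracles with internal state in `σ`: state and query give reply and new state. -/
abbrev Oracle (σ : Type) : Type := σ → List Bool → PMF (List Bool × σ)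

/-- A configuration: the programs still to be run, the registers, and the oracle's state. -/
structure Config (σ : Type) : Type where
  todo : List Prog
  regs : Regs
  env : σ

/-- One step of computation; a configuration with nothing left to run has halted. -/
def step {σ : Type} (O : Oracle σ) : Config σ → PMF (Config σ)
  | ⟨[], ρ, e⟩ => PMF.pure ⟨[], ρ, e⟩
  | ⟨.skip :: t, ρ, e⟩ => PMF.pure ⟨t, ρ, e⟩
  | ⟨.push r b :: t, ρ, e⟩ => PMF.pure ⟨t, Function.update ρ r (ρ r ++ [b]), e⟩
  | ⟨.pop r :: t, ρ, e⟩ => PMF.pure ⟨t, Function.update ρ r (ρ r).tail, e⟩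
  | ⟨.flip r :: t, ρ, e⟩ =>
      (PMF.uniformOfFintype Bool).map fun b => ⟨t, Function.update ρ r (ρ r ++ [b]), e⟩
  | ⟨.seq p q :: t, ρ, e⟩ => PMF.pure ⟨p :: q :: t, ρ, e⟩
  | ⟨.ite r p q :: t, ρ, e⟩ => PMF.pure ⟨(if (ρ r).headD false then p else q) :: t, ρ, e⟩
  | ⟨.loop r p :: t, ρ, e⟩ =>
      PMF.pure ⟨if ρ r = [] then t else p :: .loop r p :: t, ρ, e⟩
  | ⟨.call :: t, ρ, e⟩ => (O e (ρ 0)).map fun a => ⟨t, Function.update ρ 0 a.1, a.2⟩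

/-- `n` steps of computation. -/
def runFor {σ : Type} (O : Oracle σ) : ℕ → Config σ → PMF (Config σ)
  | 0, c => PMF.pure c
  | n + 1, c => (step O c).bind (runFor O n)

/-- Whatever the coins and the oracle's random choices, `c` halts within `n` steps. -/
def HaltsIn {σ : Type} (O : Oracle σ) (n : ℕ) (c : Config σ) : Prop :=
  ∀ d ∈ (runFor O n c).support, d.todo = []

/-- Initial registers: the security parameter `k` and the public length `a`, both in unary. -/
def initRegs (k a : ℕ) : Regs
  | 0 => List.replicate k true
  | 1 => List.replicate a true
  | _ => []

/-! ## Selective simulation-based security -/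

/-- An adversary: an oracle program and a polynomial in the security parameter. -/
structure Adversary : Type where
  prog : Prog
  time : Polynomial ℕ

/-- The adversary runs in the claimed polynomial time: it halts within `time(k)` steps against
every oracle whose replies have at most `L k` bits. -/
def Adversary.PolyTime (A : Adversary) (a L : ℕ → ℕ) : Prop :=
  ∀ (k : ℕ) (σ : Type) (O : Oracle σ) (e₀ : σ),
    (∀ e q, ∀ y ∈ (O e q).support, y.1.length ≤ L k) →
      HaltsIn O (A.time.eval k) ⟨[A.prog], initRegs k (a k), e₀⟩

/-- The bit that the adversary outputs: the front bit of register `0` at the end. -/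
def Adversary.output {σ : Type} (A : Adversary) (k a : ℕ) (O : Oracle σ) (e₀ : σ) : PMF Bool :=
  (runFor O (A.time.eval k) ⟨[A.prog], initRegs k a, e₀⟩).map fun c => (c.regs 0).headD false

/-- The oracle of a program that talks to nobody. -/
def silent : Oracle Unit := fun _ _ => PMF.pure ([], ())

/-- A stateful simulator: `setup` is run once, `answer` once per query. The registers persist;
input and output stand in register `0`. -/
structure Simulator : Type where
  setup : Prog
  answer : Prog
  time : Polynomial ℕ

/-- Registers after the simulator's setup. -/
def Simulator.begin (S : Simulator) (k a : ℕ) : PMF Regs :=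
  (runFor silent (S.time.eval k) ⟨[S.setup], initRegs k a, ()⟩).map Config.regs

/-- Registers after the simulator, having given `i` answers, is run on the further input `s`. -/
def Simulator.next (S : Simulator) (k i : ℕ) (ρ : Regs) (s : List Bool) : PMF Regs :=
  (runFor silent (S.time.eval (k + i)) ⟨[S.answer], Function.update ρ 0 s, ()⟩).map Config.regs

/-- The register contents that can occur after `i` answers to inputs of length `len`. -/
def Simulator.states (S : Simulator) (k a len : ℕ) : ℕ → Set Regs
  | 0 => (S.begin k a).support
  | i + 1 => {ρ' | ∃ ρ ∈ S.states k a len i, ∃ s : List Bool,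
      s.length = len ∧ ρ' ∈ (S.next k i ρ s).support}

/-- The simulator runs in the claimed polynomial time: setup takes at most `time(k)` steps, and
the answer to a query that follows `i` earlier ones at most `time(k + i)` steps. -/
def Simulator.PolyTime (S : Simulator) (a len : ℕ → ℕ) : Prop :=
  ∀ k : ℕ,
    HaltsIn silent (S.time.eval k) ⟨[S.setup], initRegs k (a k), ()⟩ ∧
    ∀ i, ∀ ρ ∈ S.states k (a k) (len k) i, ∀ s : List Bool, s.length = len k →
      HaltsIn silent (S.time.eval (k + i)) ⟨[S.answer], Function.update ρ 0 s, ()⟩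

/-- The data of a real/ideal experiment at one security parameter. The first message of the
adversary is the challenge, which is encrypted; all further ones are adaptive queries. -/
structure Experiment : Type 1 where
  Key : Type
  /-- key generation -/
  setup : PMF Key
  /-- encryption of the challenge -/
  encrypt : Key → List Bool → List Bool
  /-- the real answer to a query -/
  answer : Key → List Bool → PMF (List Bool)
  /-- what the simulator is told about challenge and query (nothing when only the challenge is
  there) -/
  leak : List Bool → List Bool → PMF (List Bool)
  /-- lengths of encrypted challenges, of answers and of leakages -/
  encLen : ℕ
  ansLen : ℕ
  leakLen : ℕ

/-- The real experiment's oracle; the flag tells whether the challenge has been given. -/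
def Experiment.realOracle (G : Experiment) : Oracle (G.Key × Bool)
  | (κ, false), x => PMF.pure (G.encrypt κ x, (κ, true))
  | (κ, true), q => (G.answer κ q).map fun y => (y, (κ, true))

/-- The ideal experiment's oracle: the simulator answers, knowing only the leakage. The state
holds the challenge, the simulator's registers and the number of answers so far. -/
def Experiment.idealOracle (G : Experiment) (S : Simulator) (k a : ℕ) :
    Oracle (Option (List Bool × Regs × ℕ))
  | none, x => (S.begin k a).map fun ρ => (fit G.encLen (ρ 0), some (x, ρ, 0))
  | some (x, ρ, i), q =>
      (G.leak x q).bind fun l =>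
        (S.next k i ρ l).map fun ρ' => (fit G.ansLen (ρ' 0), some (x, ρ', i + 1))

/-- Output of the adversary in the real experiment. -/
def Experiment.real (G : Experiment) (A : Adversary) (k a : ℕ) : PMF Bool :=
  G.setup.bind fun κ => A.output k a G.realOracle (κ, false)

/-- Output of the adversary in the ideal experiment. -/
def Experiment.ideal (G : Experiment) (S : Simulator) (A : Adversary) (k a : ℕ) : PMF Bool :=
  A.output k a (G.idealOracle S k a) none

/-- Negligible functions of the security parameter. -/
def Negligible (f : ℕ → ℝ) : Prop :=
  Asymptotics.SuperpolynomialDecay Filter.atTop (fun k : ℕ => (k : ℝ)) f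

/-- Selective simulation security of a family of experiments: there is a polynomial-time
simulator such that no probabilistic polynomial-time adversary tells the real experiment from
the ideal one with more than negligible advantage. (`a k` is a public length.) -/
def SimulationSecure (a : ℕ → ℕ) (G : ℕ → Experiment) : Prop :=
  ∃ S : Simulator, S.PolyTime a (fun k => (G k).leakLen) ∧
    ∀ A : Adversary, A.PolyTime a (fun k => max (G k).encLen (G k).ansLen) →
      Negligible fun k =>
        |((G k).real A k (a k) true).toReal - ((G k).ideal S A k (a k) true).toReal|

/-! ## SHVE and SHVE+ -/

/-- The payload length in bytes, which is the dimension of all vectors. -/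
def mtu : ℕ := 1500

/-- Attribute vectors, which are the packet payloads. -/
abbrev Payload : Type := Fin mtu → Byte

/-- Predicate vectors; `none` is the wildcard. -/
abbrev Pred : Type := Fin mtu → Option Byte

/-- The predicate function. -/
abbrev Matches (v : Pred) (x : Payload) : Prop := ∀ l, v l = some (x l) ∨ v l = none

/-- The non-wildcard positions of a predicate vector. -/
def support (v : Pred) : Bits mtu := fun l => (v l).isSome

/-- The function family `F0` and the symmetric encryption scheme `Sym` (whose keys are uniform
`k`-bit strings), for all security parameters `k`. -/
structure Primitives : Type where
  F0 : (k : ℕ) → Bits k → Byte → Fin mtu → Bits k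
  /-- length of the ciphertexts of `Sym` -/
  ctLen : ℕ → ℕ
  ctLen_le : ∃ p : Polynomial ℕ, ∀ k, ctLen k ≤ p.eval k
  enc : (k : ℕ) → Bits k → Bits k → PMF (Bits (ctLen k))
  dec : (k : ℕ) → Bits k → Bits (ctLen k) → Option (Bits k)
  dec_enc : ∀ (k : ℕ) (K m : Bits k), ∀ c ∈ (enc k K m).support, dec k K c = some m

variable (pr : Primitives) (k : ℕ)

/-- Trapdoors `(d₀, d₁, S)`. -/
structure Trapdoor : Type where
  d0 : Bits k
  d1 : Bits (pr.ctLen k)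
  S : Bits mtu

/-- Ciphertexts of SHVE and SHVE+. -/
abbrev Cipher : Type := Fin mtu → Bits k

/-- Exclusive or of the `w l` over all `l` in `S`. -/
def xorOver {k : ℕ} (S : Bits mtu) (w : Fin mtu → Bits k) : Bits k :=
  fun i => ((List.finRange mtu).map fun l => S l && w l i).foldr xor false

/-- Setup of SHVE and SHVE+: a uniform master secret key. -/
def shveSetup : PMF (Bits k) := PMF.uniformOfFintype (Bits k)

/-- Encryption of SHVE and SHVE+. -/
def shveEnc (msk : Bits k) (x : Payload) : Cipher k := fun l => pr.F0 k msk (x l) l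

/-- SHVE+ trapdoor generation. -/
def shvePlusKeyGen (msk : Bits k) (v : Pred) (m : Bits k) : PMF (Trapdoor pr k) := do
  let K ← PMF.uniformOfFintype (Bits k)
  let d1 ← pr.enc k K m
  let mask := xorOver (support v) fun l => pr.F0 k msk ((v l).getD default) l
  return ⟨fun i => xor (mask i) (K i), d1, support v⟩

/-- The message `0`. -/
def zeroMsg : Bits k := fun _ => false

/-- SHVE trapdoor generation: the encrypted message is `0`. -/
def shveKeyGen (msk : Bits k) (v : Pred) : PMF (Trapdoor pr k) :=
  shvePlusKeyGen pr k msk v (zeroMsg k)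

/-- SHVE+ query. -/
def shvePlusQuery (t : Trapdoor pr k) (c : Cipher k) : Option (Bits k) :=
  pr.dec k (fun i => xor (xorOver t.S c i) (t.d0 i)) t.d1

/-- SHVE query. -/
def shveQuery (t : Trapdoor pr k) (c : Cipher k) : Bool :=
  decide (shvePlusQuery pr k t c = some (zeroMsg k))

/-! Encodings of the objects that are sent. -/

variable {pr k} in
/-- A trapdoor as a string. -/
def Trapdoor.write (t : Trapdoor pr k) : List Bool :=
  List.ofFn t.S ++ List.ofFn t.d0 ++ List.ofFn t.d1

/-- The length of an encoded trapdoor. -/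
def tdLen : ℕ := mtu + k + pr.ctLen k

/-- A ciphertext as a string. -/
def writeCipher {k : ℕ} (c : Cipher k) : List Bool :=
  (List.ofFn fun l => List.ofFn (c l)).flatten

/-- Read a payload from a string. -/
def readPayload (s : List Bool) : Payload := fun l => readBits 8 (8 * l) s

/-- Read a predicate vector from a string: nine bits for each entry, the first of which tells
whether the entry is a byte or the wildcard. -/
def readPred (s : List Bool) : Pred := fun l =>
  if s.getD (9 * l) false then some (readBits 8 (9 * l + 1) s) else none

/-- Read the message that follows a predicate vector. -/
def readMsg (s : List Bool) : Bits k := readBits k (9 * mtu) s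

/-- The experiment for SHVE. The leakage consists of `α(v)`, the non-wildcard positions, and
`β(v, x)`, the truth value of the predicate. -/
def shveExperiment : Experiment where
  Key := Bits k
  setup := shveSetup k
  encrypt msk s := writeCipher (shveEnc pr k msk (readPayload s))
  answer msk q := (shveKeyGen pr k msk (readPred q)).map Trapdoor.write
  leak s q := PMF.pure
    (List.ofFn (support (readPred q)) ++ [decide (Matches (readPred q) (readPayload s))])
  encLen := mtu * k
  ansLen := tdLen pr k
  leakLen := mtu + 1

/-- The leakage `β'(v, x)` of SHVE+: the message if the predicate holds, else a uniform string. -/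
def betaPlus (v : Pred) (m : Bits k) (x : Payload) : PMF (Bits k) :=
  if Matches v x then PMF.pure m else PMF.uniformOfFintype (Bits k)

/-- The experiment for SHVE+. The leakage consists of `α(v)` and `β'(v, x)`. -/
def shvePlusExperiment : Experiment where
  Key := Bits k
  setup := shveSetup k
  encrypt msk s := writeCipher (shveEnc pr k msk (readPayload s))
  answer msk q := (shvePlusKeyGen pr k msk (readPred q) (readMsg k q)).map Trapdoor.write
  leak s q := (betaPlus k (readPred q) (readMsg k q) (readPayload s)).map fun b =>
    List.ofFn (support (readPred q)) ++ List.ofFn b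
  encLen := mtu * k
  ansLen := tdLen pr k
  leakLen := mtu + k

/-! ## The pattern matching protocol -/

/-- A rule: the pattern, with its string, offset and depth, and the action. -/
structure Rule : Type where
  string : List Byte
  offset : ℕ
  depth : ℕ
  act : Bits k

section
variable {k}

/-- First position to be checked (positions are counted from `1`). -/
def Rule.first (r : Rule k) : ℕ := if 0 < r.offset then r.offset else 1

/-- Last position that the pattern may occupy; it never exceeds the payload. -/
def Rule.last (r : Rule k) : ℕ := if 0 < r.depth then min (r.first + r.depth) mtu else mtu

/-- All starting positions `first, …, last - len + 1`. -/
def Rule.positions (r : Rule k) : List ℕ :=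
  List.range' r.first (r.last + 2 - r.string.length - r.first)

/-- The predicate vector with the string `w` inserted at position `i` and wildcards elsewhere. -/
def placeAt (w : List Byte) (i : ℕ) : Pred := fun l =>
  if i ≤ l.val + 1 then w[l.val + 1 - i]? else none

/-- The predicate vector for the whole pattern at position `i`. -/
def Rule.pattern (r : Rule k) (i : ℕ) : Pred := placeAt r.string i

/-- The predicate vector of the first-level filter: bytes 1 and 2 of the string. -/
def Rule.level1 (r : Rule k) (i : ℕ) : Pred := placeAt (r.string.take 2) i

/-- The predicate vector of the second-level filter: bytes 3 and 4 of the string. -/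
def Rule.level2 (r : Rule k) (i : ℕ) : Pred := placeAt ((r.string.drop 2).take 2) (i + 2)

end

/-- Encrypted rule generation. -/
def generate (msk : Bits k) (R : List (Rule k)) : PMF (List (Trapdoor pr k)) := do
  let ts ← R.mapM fun r => r.positions.mapM fun i => shvePlusKeyGen pr k msk (r.pattern i) r.act
  return ts.flatten

/-- The encrypted filter. -/
structure EncFilter : Type where
  F1 : List (Trapdoor pr k)
  F2 : List (Trapdoor pr k)
  F3 : List (Trapdoor pr k)

/-- The part of the encrypted filter that belongs to one rule. -/
def ruleFilter (msk : Bits k) (r : Rule k) : PMF (EncFilter pr k) :=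
  if r.string.length ≤ 3 then do
    let ts ← r.positions.mapM fun i => shveKeyGen pr k msk (r.level1 i)
    return ⟨ts, [], []⟩
  else do
    let ts ← r.positions.mapM fun i => do
      let t ← shveKeyGen pr k msk (r.level1 i)
      let t' ← shveKeyGen pr k msk (r.level2 i)
      return (t, t')
    return ⟨[], ts.map Prod.fst, ts.map Prod.snd⟩

/-- Encrypted filter generation. -/
def filterGenerate (msk : Bits k) (R : List (Rule k)) : PMF (EncFilter pr k) := do
  let fs ← R.mapM (ruleFilter pr k msk)
  return ⟨(fs.map EncFilter.F1).flatten, (fs.map EncFilter.F2).flatten,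
    (fs.map EncFilter.F3).flatten⟩

/-- Secure filtering on the middlebox (a keyless computation): the possible matching positions,
given as the position sets of first-level trapdoors. -/
def filtering (F : EncFilter pr k) (c : Cipher k) : List (Bits mtu) :=
  ((F.F1.filter (shveQuery pr k · c)).map Trapdoor.S) ++
    (F.F2.filter (shveQuery pr k · c)).flatMap fun t =>
      (F.F3.filter (shveQuery pr k · c)).map fun _ => t.S

/-- Rule matching on the middlebox (a keyless computation): the recovered actions. -/
def matching (E : List (Trapdoor pr k)) (c : Cipher k) : List (Option (Bits k)) :=
  E.map (shvePlusQuery pr k · c)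

/-- What is leaked about a packet by a rule: the range and length of the rule's pattern, the
possible matching positions `Pos_f` (hits of the first-level and of the second-level filter),
the matched positions `Pos_e`, and the action `Act`, which is `none` if there is no match. -/
structure Leakage : Type where
  len : ℕ
  first : ℕ
  last : ℕ
  posF1 : List ℕ
  posF2 : List ℕ
  posE : List ℕ
  act : Option (Bits k)

variable {k} in
/-- The leakage function (the component that belongs to the rule `r`). -/
def leakL1 (x : Payload) (r : Rule k) : Leakage k where
  len := r.string.length
  first := r.first
  last := r.last
  posF1 := r.positions.filter fun i => Matches (r.level1 i) x
  posF2 := if r.string.length ≤ 3 then [] else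
    r.positions.filter fun i => Matches (r.level2 i) x
  posE := r.positions.filter fun i => Matches (r.pattern i) x
  act := if ∃ i ∈ r.positions, Matches (r.pattern i) x then some r.act else none

/-! Encodings of the objects that are sent. -/

/-- Read a rule from a string: a non-empty string of at most `mtu` bytes, with offset and depth
at most `mtu`. -/
def readRule (s : List Bool) : Rule k where
  string := (List.ofFn fun l : Fin mtu => readBits 8 (mtu + 8 * l) s).take
    (1 + readNat (mtu - 1) 0 s)
  offset := readNat mtu (9 * mtu) s
  depth := readNat mtu (10 * mtu) s
  act := readBits k (11 * mtu) s

/-- A set of positions as a string. -/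
def writePositions (l : List ℕ) : List Bool :=
  List.ofFn fun i : Fin mtu => decide (i.val + 1 ∈ l)

variable {k} in
/-- A leakage as a string. -/
def Leakage.write (L : Leakage k) : List Bool :=
  writeNat mtu L.len ++ writeNat mtu L.first ++ writeNat mtu L.last ++
    writePositions L.posF1 ++ writePositions L.posF2 ++ writePositions L.posE ++
    match L.act with
    | none => List.replicate (1 + k) false
    | some m => true :: List.ofFn m

variable {pr k} in
/-- A list of at most `mtu` trapdoors as a string: `mtu` slots with a presence bit. -/
def writeTrapdoors (ts : List (Trapdoor pr k)) : List Bool :=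
  (List.ofFn fun j : Fin mtu =>
    match ts[j.val]? with
    | none => List.replicate (1 + tdLen pr k) false
    | some t => true :: t.write).flatten

/-- The experiment for the protocol: the adversary picks a packet and gets its encryption; then
it adaptively picks rules `r` and gets the encrypted patterns and the encrypted filter for `r`,
generated with the same master secret key. -/
def protocolExperiment : Experiment where
  Key := Bits k
  setup := shveSetup k
  encrypt msk s := writeCipher (shveEnc pr k msk (readPayload s))
  answer msk q := do
    let E ← generate pr k msk [readRule k q]
    let F ← filterGenerate pr k msk [readRule k q]
    return writeTrapdoors E ++ writeTrapdoors F.F1 ++ writeTrapdoors F.F2 ++ writeTrapdoors F.F3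
  leak s q := PMF.pure (leakL1 (readPayload s) (readRule k q)).write
  encLen := mtu * k
  ansLen := 4 * (mtu * (1 + tdLen pr k))
  leakLen := 6 * mtu + (1 + k)

/-- SHVE is selectively simulation-secure. -/
def SHVESecure (pr : Primitives) : Prop := SimulationSecure pr.ctLen (shveExperiment pr)

/-- SHVE+ is selectively simulation-secure. -/
def SHVEPlusSecure (pr : Primitives) : Prop := SimulationSecure pr.ctLen (shvePlusExperiment pr)

/-- The pattern matching protocol is secure with the above leakage against adversaries that
pick a packet and then adaptively request encrypted patterns and filters. -/
def ProtocolSecureL1 (pr : Primitives) : Prop :=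
  SimulationSecure pr.ctLen (protocolExperiment pr)

end

end PatternMatching

namespace PatternMatching

/-! ## Composition of program runs -/

/-! A SHVE trapdoor is by definition a SHVE+ trapdoor for the zero message, and patterns and filters
share one master key. So the real reply to a rule is a row of `4 * mtu` slots, each empty or holding
a SHVE+ trapdoor generated with fresh coins under that key (`protocol_answer`). An adversary A on
the protocol therefore becomes an adversary B on SHVE+: B passes the packet on, and answers each
rule of A by asking for these trapdoors one after the other. In the real experiments A and B have
exactly the same output law (`real_eq`).

On the ideal side, let S be the simulator for SHVE+. The protocol's simulator runs S once for each
filled slot, on a SHVE+ leakage that it samples from the protocol's leakage (`leakPlan_eq`). The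
non-wildcard positions depend only on the position and the length of the string; the leaked position
lists tell whether the vector matches; upon a match the message is the leaked action or zero;
without a match `betaPlus` is uniform, which can be sampled without further knowledge. Hence B
against S has exactly the output law of A against the new simulator (`ideal_eq`). The two advantages
are equal for every security parameter, so no hybrid argument is needed.

Most of the work lies in the cost model, since B and the new simulator must be programs with
polynomial time bounds. Both have the same task, to turn one query into a fixed number of
subqueries, so a single program `serve` is verified (`exec_serve`), with the subroutine that puts a
subquery as a parameter (`Implements`): an oracle call for B, the program `S.answer` for the
simulator. Their common meaning is `runPlan`. The choice of the subqueries depends on a number of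
bits that does not grow with the security parameter, so it is wired into the program as a decision
tree; only messages and replies need loops over unary counters. `exec_replaceCall` puts this program
in place of A's oracle calls (`exists_reduction`), and `batch_polyTime` bounds the simulator. -/

theorem pmf_bind_congr {α β : Type*} {p : PMF α} {f g : α → PMF β}
    (h : ∀ a ∈ p.support, f a = g a) : p.bind f = p.bind g := by
  ext b
  simp only [PMF.bind_apply]
  refine tsum_congr fun a => ?_
  by_cases ha : a ∈ p.support
  · rw [h a ha]
  · rw [PMF.apply_eq_zero_iff _ _ |>.2 ha, zero_mul, zero_mul]

theorem pmf_map_congr {α β : Type*} {p : PMF α} {f g : α → β}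
    (h : ∀ a ∈ p.support, f a = g a) : p.map f = p.map g :=
  pmf_bind_congr fun a ha => by simp [h a ha]

section Semantics

variable {σ : Type} {O : Oracle σ}

theorem runFor_nil (n : ℕ) (ρ : Regs) (e : σ) :
    runFor O n ⟨[], ρ, e⟩ = PMF.pure ⟨[], ρ, e⟩ := by
  induction n with
  | zero => rfl
  | succ n ih => simp [runFor, step, ih]

theorem runFor_add (m n : ℕ) (c : Config σ) :
    runFor O (m + n) c = (runFor O m c).bind (runFor O n) := by
  induction m generalizing c with
  | zero => simp [runFor]
  | succ m ih =>
    rw [Nat.succ_add]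
    simp only [runFor, PMF.bind_bind]
    exact congrArg _ (funext ih)

/-- A halted configuration. -/
def halted (x : Regs × σ) : Config σ := ⟨[], x.1, x.2⟩

/-- The programs `t`, started on `ρ` and `e`, halt within `n` steps, and the final registers and
oracle state are distributed as `μ`. -/
def Exec (O : Oracle σ) (t : List Prog) (n : ℕ) (ρ : Regs) (e : σ) (μ : PMF (Regs × σ)) : Prop :=
  runFor O n ⟨t, ρ, e⟩ = μ.map halted

/-- Registers and oracle state after `n` steps. -/
noncomputable def outcome (O : Oracle σ) (n : ℕ) (c : Config σ) : PMF (Regs × σ) :=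
  (runFor O n c).map fun d => (d.regs, d.env)

/-- Brings the time claims about adversaries and simulators, which say nothing of the final law,
into the calculus of `Exec`: the law is that of the run itself. -/
theorem HaltsIn.exec {n : ℕ} {t : List Prog} {ρ : Regs} {e : σ} (h : HaltsIn O n ⟨t, ρ, e⟩) :
    Exec O t n ρ e (outcome O n ⟨t, ρ, e⟩) := by
  unfold Exec outcome
  rw [PMF.map_comp]
  conv_lhs => rw [← PMF.map_id (runFor O n ⟨t, ρ, e⟩)]
  refine pmf_map_congr fun d hd => ?_
  have := h d hd
  cases d
  simp_all [halted]

variable {t : List Prog} {n : ℕ} {ρ : Regs} {e : σ} {μ : PMF (Regs × σ)}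

theorem Exec.haltsIn (h : Exec O t n ρ e μ) : HaltsIn O n ⟨t, ρ, e⟩ := by
  intro d hd
  rw [h] at hd
  obtain ⟨x, -, rfl⟩ := (PMF.mem_support_map_iff _ _ _).1 hd
  rfl

theorem Exec.outcome_eq (h : Exec O t n ρ e μ) : outcome O n ⟨t, ρ, e⟩ = μ := by
  unfold outcome
  rw [h, PMF.map_comp]
  exact PMF.map_id μ

theorem Exec.mono (h : Exec O t n ρ e μ) {m : ℕ} (hm : n ≤ m) : Exec O t m ρ e μ := by
  obtain ⟨l, rfl⟩ := Nat.exists_eq_add_of_le hm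
  unfold Exec at *
  rw [runFor_add, h, PMF.bind_map]
  exact congrArg _ (funext fun x => by simp [halted, runFor_nil])

theorem Exec.of_eq (h : Exec O t n ρ e μ) {ν : PMF (Regs × σ)} (hν : μ = ν) :
    Exec O t n ρ e ν := hν ▸ h

theorem exec_nil (ρ : Regs) (e : σ) : Exec O [] n ρ e (PMF.pure (ρ, e)) := by
  simp [Exec, runFor_nil, PMF.pure_map, halted]

/-- A first step, followed by an execution from each of the resulting configurations. -/
theorem exec_step {f : Config σ → PMF (Regs × σ)}
    (h : ∀ c ∈ (step O ⟨t, ρ, e⟩).support, Exec O c.todo n c.regs c.env (f c)) :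
    Exec O t (n + 1) ρ e ((step O ⟨t, ρ, e⟩).bind f) := by
  unfold Exec at *
  simp only [runFor, PMF.map_bind]
  exact pmf_bind_congr h

theorem exec_step_pure {c : Config σ} (hc : step O ⟨t, ρ, e⟩ = PMF.pure c)
    (h : Exec O c.todo n c.regs c.env μ) : Exec O t (n + 1) ρ e μ := by
  refine (exec_step (f := fun _ => μ) ?_).of_eq (by simp [hc])
  intro d hd
  rw [hc, PMF.mem_support_pure_iff] at hd
  rwa [hd]

/-- A step looks only at the top of the stack of programs, so what lies below is carried along
unchanged. -/
theorem step_append (p : Prog) (s t : List Prog) (ρ : Regs) (e : σ) :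
    step O ⟨p :: (s ++ t), ρ, e⟩ =
      (step O ⟨p :: s, ρ, e⟩).map fun c => ⟨c.todo ++ t, c.regs, c.env⟩ := by
  cases p <;> simp [step, PMF.pure_map, PMF.map_comp, Function.comp_def]
  split_ifs <;> simp

theorem exec_append {s : List Prog} {m : ℕ} {ν : Regs × σ → PMF (Regs × σ)}
    (h : Exec O s n ρ e μ) (h' : ∀ x ∈ μ.support, Exec O t m x.1 x.2 (ν x)) :
    Exec O (s ++ t) (n + m) ρ e (μ.bind ν) := by
  -- With the run's own outcome in place of `μ`, the induction needs no decomposition of `μ` along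
  -- the intermediate configurations.
  rw [← h.outcome_eq] at h' ⊢
  replace h := h.haltsIn
  induction n generalizing s ρ e with
  | zero =>
    have hs : s = [] := h ⟨s, ρ, e⟩ (by simp [runFor])
    subst hs
    simp only [outcome, runFor, PMF.pure_map, PMF.pure_bind] at h' ⊢
    exact (h' (ρ, e) (by simp)).mono (by omega)
  | succ n ih =>
    cases s with
    | nil =>
      simp only [outcome, runFor_nil, PMF.pure_map, PMF.pure_bind] at h' ⊢
      exact (h' (ρ, e) (by simp)).mono (by omega)
    | cons p s =>
      have key : ∀ c ∈ (step O ⟨p :: s, ρ, e⟩).support,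
          Exec O (c.todo ++ t) (n + m) c.regs c.env ((outcome O n c).bind ν) := by
        intro c hc
        refine ih ?_ ?_
        · intro x hx
          refine h' x ?_
          simp only [outcome, runFor, PMF.mem_support_map_iff, PMF.mem_support_bind_iff] at hx ⊢
          obtain ⟨d, hd, hx⟩ := hx
          exact ⟨d, ⟨c, hc, hd⟩, hx⟩
        · intro d hd
          exact h d ((PMF.mem_support_bind_iff _ _ _).2 ⟨c, hc, hd⟩)
      unfold Exec at *
      rw [show n + 1 + m = (n + m) + 1 by omega]
      simp only [runFor, List.cons_append, step_append, PMF.bind_map]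
      simp only [outcome, runFor, PMF.map_bind, PMF.bind_bind, Function.comp_def]
      refine pmf_bind_congr fun c hc => ?_
      rw [key c hc]
      simp [outcome, PMF.map_bind, PMF.bind_map, Function.comp_def]

theorem exec_append_pure {s : List Prog} {m : ℕ} {ρ' : Regs} {e' : σ}
    (h : Exec O s n ρ e (PMF.pure (ρ', e'))) (h' : Exec O t m ρ' e' μ) :
    Exec O (s ++ t) (n + m) ρ e μ := by
  refine (exec_append (ν := fun _ => μ) h ?_).of_eq (by simp)
  intro x hx
  rw [PMF.mem_support_pure_iff] at hx
  rwa [hx]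

theorem exec_seq {p q : Prog} {m : ℕ} {ν : Regs × σ → PMF (Regs × σ)}
    (h : Exec O [p] n ρ e μ) (h' : ∀ x ∈ μ.support, Exec O [q] m x.1 x.2 (ν x)) :
    Exec O [.seq p q] (n + m + 1) ρ e (μ.bind ν) :=
  exec_step_pure rfl (exec_append (s := [p]) h h')

/-- Here the second law depends on an abstract state `a` and not on the configuration `f a`. As `f`
need not be injective, `exec_seq` does not apply directly; the outcome of `q`, a function of the
configuration, mediates. -/
theorem exec_seq_map {α : Type*} {p q : Prog} {m : ℕ} {μ : PMF α} {f : α → Regs × σ}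
    {ν : α → PMF (Regs × σ)} (h : Exec O [p] n ρ e (μ.map f))
    (h' : ∀ a ∈ μ.support, Exec O [q] m (f a).1 (f a).2 (ν a)) :
    Exec O [.seq p q] (n + m + 1) ρ e (μ.bind ν) := by
  classical
  have key : ∀ x ∈ (μ.map f).support, Exec O [q] m x.1 x.2 (outcome O m ⟨[q], x.1, x.2⟩) := by
    intro x hx
    obtain ⟨a, ha, rfl⟩ := (PMF.mem_support_map_iff _ _ _).1 hx
    exact (h' a ha).haltsIn.exec
  refine (exec_seq h key).of_eq ?_
  rw [PMF.bind_map]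
  exact pmf_bind_congr fun a ha => (h' a ha).outcome_eq

theorem exec_seq_pure {p q : Prog} {m : ℕ} {ρ' : Regs} {e' : σ}
    (h : Exec O [p] n ρ e (PMF.pure (ρ', e'))) (h' : Exec O [q] m ρ' e' μ) :
    Exec O [.seq p q] (n + m + 1) ρ e μ :=
  exec_step_pure rfl (exec_append_pure (s := [p]) h h')

theorem exec_skip (ρ : Regs) (e : σ) : Exec O [.skip] 1 ρ e (PMF.pure (ρ, e)) :=
  exec_step_pure rfl (exec_nil (n := 0) _ _)

theorem exec_push (r : ℕ) (b : Bool) (ρ : Regs) (e : σ) :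
    Exec O [.push r b] 1 ρ e (PMF.pure (Function.update ρ r (ρ r ++ [b]), e)) :=
  exec_step_pure rfl (exec_nil (n := 0) _ _)

theorem exec_pop (r : ℕ) (ρ : Regs) (e : σ) :
    Exec O [.pop r] 1 ρ e (PMF.pure (Function.update ρ r (ρ r).tail, e)) :=
  exec_step_pure rfl (exec_nil (n := 0) _ _)

theorem exec_flip (r : ℕ) (ρ : Regs) (e : σ) :
    Exec O [.flip r] 1 ρ e ((PMF.uniformOfFintype Bool).map fun b =>
      (Function.update ρ r (ρ r ++ [b]), e)) := by
  simp [Exec, runFor, step, PMF.map_comp, Function.comp_def, halted]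

theorem exec_call (ρ : Regs) (e : σ) :
    Exec O [.call] 1 ρ e ((O e (ρ 0)).map fun a => (Function.update ρ 0 a.1, a.2)) := by
  simp [Exec, runFor, step, PMF.map_comp, Function.comp_def, halted]

theorem exec_ite {r : ℕ} {p q : Prog}
    (h : Exec O [if (ρ r).headD false then p else q] n ρ e μ) :
    Exec O [.ite r p q] (n + 1) ρ e μ :=
  exec_step_pure rfl h

theorem exec_loop_nil {r : ℕ} {p : Prog} (h : ρ r = []) :
    Exec O [.loop r p] 1 ρ e (PMF.pure (ρ, e)) :=
  exec_step_pure rfl (by simpa [h] using exec_nil (n := 0) ρ e)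

theorem exec_loop_cons {r : ℕ} {p : Prog} {m : ℕ} {α : Type*} {μ : PMF α} {f : α → Regs × σ}
    {ν : α → PMF (Regs × σ)} (hr : ρ r ≠ []) (h : Exec O [p] n ρ e (μ.map f))
    (h' : ∀ a ∈ μ.support, Exec O [.loop r p] m (f a).1 (f a).2 (ν a)) :
    Exec O [.loop r p] (n + m + 1) ρ e (μ.bind ν) := by
  refine exec_step_pure rfl ?_
  -- Entering a loop on a non-empty register and unfolding `seq p (loop r p)` lead in one step to
  -- the same configuration.
  have := exec_seq_map h h'
  simp only [hr, if_false]
  unfold Exec at this ⊢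
  rw [show n + m + 1 = 1 + (n + m) by omega, runFor_add] at this
  simpa [runFor, step] using this

end Semantics

/-! ## Basic programs -/

/-- Run `body` once for each bit of the unary counter `c`, with scratch register `tmp`. -/
def forCount (c tmp : ℕ) (body : Prog) : Prog :=
  .seq (.loop c (.seq (.pop c) (.seq (.push tmp true) body)))
    (.loop tmp (.seq (.pop tmp) (.push c true)))

/-- Move a bit from `src` to `dst`, reading `false` if there is none. -/
def moveBit (src dst : ℕ) : Prog :=
  .seq (.ite src (.push dst true) (.push dst false)) (.pop src)

/-- Run `p` repeatedly, `n` times. -/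
def rep (p : Prog) : ℕ → Prog
  | 0 => .skip
  | n + 1 => .seq p (rep p n)

/-- Delete the contents of a register. -/
def clear (r : ℕ) : Prog := .loop r (.pop r)

/-- Append the contents of `src` to `dst` and clear `src`. -/
def moveAll (src dst : ℕ) : Prog := .loop src (moveBit src dst)

/-- Append a constant string. -/
def pushAll (r : ℕ) : List Bool → Prog
  | [] => .skip
  | b :: s => .seq (.push r b) (pushAll r s)

/-- Append to `dst` a copy of `src`, which is rotated once. -/
def copyReg (c tmp src dst : ℕ) : Prog :=
  forCount c tmp (.seq (.ite src (.seq (.push dst true) (.push src true))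
    (.seq (.push dst false) (.push src false))) (.pop src))

/-- Read `n` bits of register `r` and continue with a program that depends on them. -/
def readThen (r : ℕ) : ℕ → (List Bool → Prog) → Prog
  | 0, f => f []
  | n + 1, f => .ite r (.seq (.pop r) (readThen r n fun w => f (true :: w)))
      (.seq (.pop r) (readThen r n fun w => f (false :: w)))

/-- Iteration of a probabilistic map. -/
noncomputable def iterate {α : Type*} (f : α → PMF α) : ℕ → α → PMF α
  | 0, x => PMF.pure x
  | n + 1, x => (f x).bind (iterate f n)

/-- The registers `ρ` with counters `c` and `tmp`. -/
def withCounters (c tmp i j : ℕ) (ρ : Regs) : Regs :=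
  Function.update (Function.update ρ c (List.replicate i true)) tmp (List.replicate j true)

section

variable {σ : Type} {O : Oracle σ}

theorem exec_restore {c tmp : ℕ} (h : c ≠ tmp) (ρ : Regs) (e : σ) (i j : ℕ) :
    Exec O [.loop tmp (.seq (.pop tmp) (.push c true))] (4 * j + 1) (withCounters c tmp i j ρ) e
      (PMF.pure (withCounters c tmp (i + j) 0 ρ, e)) := by
  induction j generalizing i with
  | zero => exact exec_loop_nil (by simp [withCounters])
  | succ j ih =>
    have h1 : Exec O [.seq (.pop tmp) (.push c true)] 3 (withCounters c tmp i (j + 1) ρ) e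
        ((PMF.pure ()).map fun _ => (withCounters c tmp (i + 1) j ρ, e)) := by
      have e1 : Function.update (withCounters c tmp i (j + 1) ρ) tmp
          (withCounters c tmp i (j + 1) ρ tmp).tail = withCounters c tmp i j ρ := by
        funext r
        simp only [withCounters, Function.update_apply]
        split_ifs <;> simp_all
      have e2 : Function.update (withCounters c tmp i j ρ) c
          (withCounters c tmp i j ρ c ++ [true]) = withCounters c tmp (i + 1) j ρ := by
        funext r
        simp only [withCounters, Function.update_apply]
        split_ifs <;> simp_all [List.replicate_succ']
      refine exec_seq_pure (n := 1) (m := 1) (exec_pop _ _ _) ?_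
      rw [e1, PMF.pure_map, ← e2]
      exact exec_push _ _ _ _
    refine (exec_loop_cons (by simp [withCounters, List.replicate_succ]) h1
      (ν := fun _ => PMF.pure (withCounters c tmp (i + (j + 1)) 0 ρ, e)) ?_).mono
      (m := 4 * (j + 1) + 1) (n := 3 + (4 * j + 1) + 1) (by omega) |>.of_eq (by simp)
    intro a _
    rw [show i + (j + 1) = i + 1 + j by omega]
    exact ih (i + 1)

/-- The counter and its scratch copy change between the rounds, so the body's effect is required for
all their contents `i` and `j`. Each round costs five steps besides the body: loop, two
compositions, pop, push. -/
theorem exec_count_loop {α : Type*} {f : α → PMF α} {reg : α → Regs} {env : α → σ} {T : ℕ}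
    {c tmp : ℕ} {body : Prog} (h : c ≠ tmp)
    (hb : ∀ x i j, Exec O [body] T (withCounters c tmp i j (reg x)) (env x)
      ((f x).map fun y => (withCounters c tmp i j (reg y), env y))) (i j : ℕ) (x : α) :
    Exec O [.loop c (.seq (.pop c) (.seq (.push tmp true) body))] (i * (T + 5) + 1)
      (withCounters c tmp i j (reg x)) (env x)
      ((iterate f i x).map fun y => (withCounters c tmp 0 (j + i) (reg y), env y)) := by
  induction i generalizing j x with
  | zero =>
    refine Exec.of_eq ((exec_loop_nil ?_).mono (by omega)) (by simp [iterate, PMF.pure_map])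
    simp [withCounters, h]
  | succ i ih =>
    have e1 : Function.update (withCounters c tmp (i + 1) j (reg x)) c
        (withCounters c tmp (i + 1) j (reg x) c).tail = withCounters c tmp i j (reg x) := by
      funext r
      simp only [withCounters, Function.update_apply]
      split_ifs <;> simp_all
    have e2 : Function.update (withCounters c tmp i j (reg x)) tmp
        (withCounters c tmp i j (reg x) tmp ++ [true]) = withCounters c tmp i (j + 1) (reg x) := by
      funext r
      simp only [withCounters, Function.update_apply]
      split_ifs <;> simp_all [List.replicate_succ']
    have h1 : Exec O [.seq (.pop c) (.seq (.push tmp true) body)] (1 + (1 + T + 1) + 1)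
        (withCounters c tmp (i + 1) j (reg x)) (env x)
        ((f x).map fun y => (withCounters c tmp i (j + 1) (reg y), env y)) := by
      refine exec_seq_pure (exec_pop _ _ _) ?_
      rw [e1]
      refine exec_seq_pure (exec_push _ _ _ _) ?_
      rw [e2]
      exact hb x i (j + 1)
    refine ((exec_loop_cons (by simp [withCounters, h, List.replicate_succ]) h1
      (ν := fun y => (iterate f i y).map fun z =>
        (withCounters c tmp 0 (j + (i + 1)) (reg z), env z)) ?_).mono
      (n := 1 + (1 + T + 1) + 1 + (i * (T + 5) + 1) + 1) (by ring_nf; omega)).of_eq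
      (by simp [iterate, PMF.map_bind])
    intro y _
    rw [show j + (i + 1) = j + 1 + i by omega]
    exact ih (j + 1) y

theorem exec_forCount {α : Type*} {f : α → PMF α} {reg : α → Regs} {env : α → σ} {T : ℕ}
    {c tmp : ℕ} {body : Prog} (h : c ≠ tmp)
    (hb : ∀ x i j, Exec O [body] T (withCounters c tmp i j (reg x)) (env x)
      ((f x).map fun y => (withCounters c tmp i j (reg y), env y))) {n : ℕ}
    (hc : ∀ x, reg x c = List.replicate n true) (ht : ∀ x, reg x tmp = []) (x : α) :
    Exec O [forCount c tmp body] (n * (T + 9) + 3) (reg x) (env x)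
      ((iterate f n x).map fun y => (reg y, env y)) := by
  have key : ∀ x, withCounters c tmp n 0 (reg x) = reg x := by
    intro x
    funext r
    simp only [withCounters, Function.update_apply]
    split_ifs <;> simp_all
  have h1 := exec_count_loop h hb n 0 x
  rw [key] at h1
  refine ((exec_seq_map h1 (ν := fun y => PMF.pure (reg y, env y)) (m := 4 * n + 1) ?_).mono
    (by ring_nf; omega)).of_eq rfl
  intro y _
  have := exec_restore (O := O) h (reg y) (env y) 0 (0 + n)
  simp only [zero_add, key] at this ⊢
  exact this

theorem exec_clear (r : ℕ) (ρ : Regs) (e : σ) :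
    Exec O [clear r] (2 * (ρ r).length + 1) ρ e (PMF.pure (Function.update ρ r [], e)) := by
  generalize hs : ρ r = s
  induction s generalizing ρ with
  | nil => exact (exec_loop_nil hs).of_eq (by rw [← hs, Function.update_eq_self])
  | cons b s ih =>
    have h1 : Exec O [.pop r] 1 ρ e
        ((PMF.pure ()).map fun _ => (Function.update ρ r s, e)) :=
      (exec_pop _ _ _).of_eq (by simp [hs, PMF.pure_map])
    refine ((exec_loop_cons (by simp [hs]) h1
      (ν := fun _ => PMF.pure (Function.update ρ r [], e)) (m := 2 * s.length + 1) ?_).mono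
      (by simp only [List.length_cons]; omega)).of_eq (by simp)
    intro _ _
    simpa [clear] using ih (Function.update ρ r s) (by simp)

theorem exec_moveBit {src dst : ℕ} (h : src ≠ dst) (ρ : Regs) (e : σ) :
    Exec O [moveBit src dst] 4 ρ e
      (PMF.pure (Function.update (Function.update ρ src (ρ src).tail) dst
        (ρ dst ++ [(ρ src).headD false]), e)) := by
  refine (exec_seq_pure (n := 2) (ρ' := Function.update ρ dst (ρ dst ++ [(ρ src).headD false]))
    (e' := e) (exec_ite ?_) (exec_pop _ _ _)).of_eq ?_
  · cases (ρ src).headD false <;> exact exec_push _ _ _ _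
  · rw [Function.update_of_ne h, Function.update_comm h]

theorem exec_moveAll {src dst : ℕ} (h : src ≠ dst) (ρ : Regs) (e : σ) :
    Exec O [moveAll src dst] (5 * (ρ src).length + 1) ρ e
      (PMF.pure (Function.update (Function.update ρ src []) dst (ρ dst ++ ρ src), e)) := by
  generalize hs : ρ src = s
  induction s generalizing ρ with
  | nil =>
    refine (exec_loop_nil hs).of_eq ?_
    rw [← hs, Function.update_eq_self, hs, List.append_nil, Function.update_eq_self]
  | cons b s ih =>
    have h1 := (exec_moveBit (O := O) h ρ e).of_eq (ν := (PMF.pure ()).map fun _ =>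
      (Function.update (Function.update ρ src s) dst (ρ dst ++ [b]), e))
      (by simp [hs, PMF.pure_map])
    refine ((exec_loop_cons (by simp [hs]) h1
      (ν := fun _ => PMF.pure (Function.update (Function.update ρ src []) dst
        (ρ dst ++ b :: s), e)) (m := 5 * s.length + 1) ?_).mono
      (by simp only [List.length_cons]; omega)).of_eq (by simp)
    intro _ _
    refine (ih _ (by simp [h])).of_eq ?_
    congr 2
    funext r
    simp only [Function.update_apply]
    split_ifs <;> simp_all

theorem exec_rep_moveBit {src dst : ℕ} (h : src ≠ dst) (n : ℕ) (ρ : Regs) (e : σ) :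
    Exec O [rep (moveBit src dst) n] (5 * n + 1) ρ e
      (PMF.pure (Function.update (Function.update ρ src ((ρ src).drop n)) dst
        (ρ dst ++ fit n (ρ src)), e)) := by
  induction n generalizing ρ with
  | zero => exact (exec_skip ρ e).of_eq (by simp [fit])
  | succ n ih =>
    refine ((exec_seq_pure (exec_moveBit h ρ e) (ih _)).mono (by omega)).of_eq ?_
    congr 2
    funext r
    simp only [Function.update_apply]
    split_ifs <;> simp_all [fit]

theorem exec_rep_push (r : ℕ) (b : Bool) (n : ℕ) (ρ : Regs) (e : σ) :
    Exec O [rep (.push r b) n] (2 * n + 1) ρ e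
      (PMF.pure (Function.update ρ r (ρ r ++ List.replicate n b), e)) := by
  induction n generalizing ρ with
  | zero => exact (exec_skip ρ e).of_eq (by simp)
  | succ n ih =>
    exact ((exec_seq_pure (exec_push r b ρ e) (ih _)).mono (by omega)).of_eq
      (by simp [List.replicate_succ])

theorem exec_pushAll (r : ℕ) (s : List Bool) (ρ : Regs) (e : σ) :
    Exec O [pushAll r s] (2 * s.length + 1) ρ e
      (PMF.pure (Function.update ρ r (ρ r ++ s), e)) := by
  induction s generalizing ρ with
  | nil => exact (exec_skip ρ e).of_eq (by simp)
  | cons b s ih =>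
    exact ((exec_seq_pure (exec_push r b ρ e) (ih _)).mono
      (by simp only [List.length_cons]; omega)).of_eq (by simp)

/-- Each bit costs a test, a composition and a pop. The branches form a tree of size exponential in
`n`, which is harmless because `n` is a constant of the program. -/
theorem exec_readThen {r n T : ℕ} {f : List Bool → Prog} {ρ : Regs} {e : σ}
    {μ : PMF (Regs × σ)}
    (h : Exec O [f (fit n (ρ r))] T (Function.update ρ r ((ρ r).drop n)) e μ) :
    Exec O [readThen r n f] (3 * n + T) ρ e μ := by
  induction n generalizing ρ f with
  | zero => simpa [fit, readThen] using h
  | succ n ih =>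
    have key : ∀ b, (ρ r).headD false = b →
        Exec O [.seq (.pop r) (readThen r n fun w => f (b :: w))] (1 + (3 * n + T) + 1) ρ e μ := by
      intro b hb
      refine exec_seq_pure (exec_pop _ _ _) (ih ?_)
      subst hb
      simpa [fit] using h
    refine Exec.mono (exec_ite (n := 1 + (3 * n + T) + 1) ?_) (by omega)
    cases hb : (ρ r).headD false
    · simpa using key false hb
    · simpa using key true hb

variable {c tmp n : ℕ} {ρ : Regs}

theorem iterate_pure {α : Type*} (g : α → α) (n : ℕ) (x : α) :
    iterate (fun x => PMF.pure (g x)) n x = PMF.pure (g^[n] x) := by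
  induction n generalizing x with
  | zero => rfl
  | succ n ih => simp [iterate, ih]

/-- The factor 20 is a common bound for `T + 9` over the loop bodies used here, whose cost `T` is at
most 6. -/
theorem exec_count_push {dst : ℕ} (h : c ≠ tmp) (hcd : c ≠ dst) (htd : tmp ≠ dst)
    (hc : ρ c = List.replicate n true) (ht : ρ tmp = []) (b : Bool) (e : σ) :
    Exec O [forCount c tmp (.push dst b)] (n * 20 + 3) ρ e
      (PMF.pure (Function.update ρ dst (ρ dst ++ List.replicate n b), e)) := by
  have := exec_forCount (O := O) (body := .push dst b) (n := n) (T := 1) (α := List Bool)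
    (f := fun s => PMF.pure (s ++ [b]))
    (reg := fun s => Function.update ρ dst s) (env := fun _ => e) h ?_
    (by simp [hcd, hc]) (by simp [htd, ht]) (ρ dst)
  · rw [Function.update_eq_self] at this
    refine (this.mono (by omega)).of_eq ?_
    rw [iterate_pure, PMF.pure_map]
    congr 3
    generalize ρ dst = s
    clear * -
    induction n generalizing s with
    | zero => simp
    | succ n ih => simp [ih, List.replicate_succ]
  · intro s i j
    refine (exec_push _ _ _ _).of_eq ?_
    rw [PMF.pure_map]
    congr 2
    funext r
    simp only [withCounters, Function.update_apply]
    split_ifs <;> simp_all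

theorem exec_count_moveBit {src dst : ℕ} (h : c ≠ tmp) (hcs : c ≠ src) (hts : tmp ≠ src)
    (hcd : c ≠ dst) (htd : tmp ≠ dst) (hsd : src ≠ dst)
    (hc : ρ c = List.replicate n true) (ht : ρ tmp = []) (e : σ) :
    Exec O [forCount c tmp (moveBit src dst)] (n * 20 + 3) ρ e
      (PMF.pure (Function.update (Function.update ρ src ((ρ src).drop n)) dst
        (ρ dst ++ fit n (ρ src)), e)) := by
  have := exec_forCount (O := O) (body := moveBit src dst) (n := n) (T := 4)
    (α := List Bool × List Bool)
    (f := fun s => PMF.pure (s.1.tail, s.2 ++ [s.1.headD false]))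
    (reg := fun s => Function.update (Function.update ρ src s.1) dst s.2) (env := fun _ => e) h ?_
    (by simp [hcd, hcs, hc]) (by simp [htd, hts, ht]) (ρ src, ρ dst)
  · rw [Function.update_eq_self, Function.update_eq_self] at this
    refine (this.mono (by omega)).of_eq ?_
    rw [iterate_pure, PMF.pure_map]
    have key : ∀ s d : List Bool,
        (fun s : List Bool × List Bool => (s.1.tail, s.2 ++ [s.1.headD false]))^[n] (s, d) =
          (s.drop n, d ++ fit n s) := by
      clear * -
      induction n with
      | zero => simp [fit]
      | succ n ih =>
        intro s d
        rw [Function.iterate_succ_apply, ih]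
        simp [fit]
    rw [key]
  · intro s i j
    refine (exec_moveBit hsd _ _).of_eq ?_
    rw [PMF.pure_map]
    congr 2
    funext r
    simp only [withCounters, Function.update_apply]
    split_ifs <;> simp_all

theorem exec_copyReg {src dst : ℕ} (h : c ≠ tmp) (hcs : c ≠ src) (hts : tmp ≠ src)
    (hcd : c ≠ dst) (htd : tmp ≠ dst) (hsd : src ≠ dst)
    (hc : ρ c = List.replicate n true) (ht : ρ tmp = []) (hs : (ρ src).length = n) (e : σ) :
    Exec O [copyReg c tmp src dst] (n * 20 + 3) ρ e
      (PMF.pure (Function.update ρ dst (ρ dst ++ ρ src), e)) := by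
  have := exec_forCount (O := O) (n := n) (T := 6)
    (body := .seq (.ite src (.seq (.push dst true) (.push src true))
      (.seq (.push dst false) (.push src false))) (.pop src))
    (α := List Bool × List Bool)
    (f := fun s => PMF.pure ((s.1 ++ [s.1.headD false]).tail, s.2 ++ [s.1.headD false]))
    (reg := fun s => Function.update (Function.update ρ src s.1) dst s.2) (env := fun _ => e) h ?_
    (by simp [hcd, hcs, hc]) (by simp [htd, hts, ht]) (ρ src, ρ dst)
  · rw [Function.update_eq_self, Function.update_eq_self] at this
    refine (this.mono (by omega)).of_eq ?_
    rw [iterate_pure, PMF.pure_map]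
    -- The bits already rotated are carried along as `s'`, so that the induction runs over the
    -- remaining ones; the full rotation is the case of empty `s'`.
    have key : ∀ s s' d : List Bool, s.length = n →
        (fun s : List Bool × List Bool =>
          ((s.1 ++ [s.1.headD false]).tail, s.2 ++ [s.1.headD false]))^[n] (s ++ s', d) =
          (s' ++ s, d ++ s) := by
      clear * -
      induction n with
      | zero => intro s s' d hs; simp [List.length_eq_zero_iff.1 hs]
      | succ n ih =>
        intro s s' d hs
        obtain ⟨b, s, rfl⟩ := List.exists_cons_of_length_eq_add_one hs
        simpa using ih s (s' ++ [b]) (d ++ [b]) (by simpa using hs)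
    have := key (ρ src) [] (ρ dst) hs
    rw [List.append_nil] at this
    rw [this, List.nil_append, Function.update_eq_self]
  · intro s i j
    have h1 : ∀ (b : Bool) (ρ' : Regs), Exec O [.seq (.push dst b) (.push src b)] 3 ρ' e
        (PMF.pure (Function.update (Function.update ρ' dst (ρ' dst ++ [b])) src
          (ρ' src ++ [b]), e)) := by
      intro b ρ'
      refine (exec_seq_pure (exec_push _ _ _ _) (exec_push _ _ _ _)).of_eq ?_
      rw [Function.update_of_ne hsd]
    have h2 : Exec O [.ite src (.seq (.push dst true) (.push src true))
        (.seq (.push dst false) (.push src false))] 4 (withCounters c tmp i j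
        (Function.update (Function.update ρ src s.1) dst s.2)) e
        (PMF.pure (Function.update (Function.update (withCounters c tmp i j
        (Function.update (Function.update ρ src s.1) dst s.2)) dst (s.2 ++ [s.1.headD false])) src
        (s.1 ++ [s.1.headD false]), e)) := by
      refine exec_ite (n := 3) ?_
      have e1 : withCounters c tmp i j
          (Function.update (Function.update ρ src s.1) dst s.2) src = s.1 := by
        simp [withCounters, hcs.symm, hts.symm, hsd]
      have e2 : withCounters c tmp i j
          (Function.update (Function.update ρ src s.1) dst s.2) dst = s.2 := by
        simp [withCounters, hcd.symm, htd.symm]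
      rw [e1]
      cases hb : s.1.headD false
      · have := h1 false (withCounters c tmp i j
          (Function.update (Function.update ρ src s.1) dst s.2))
        rw [e1, e2] at this
        simpa using this
      · have := h1 true (withCounters c tmp i j
          (Function.update (Function.update ρ src s.1) dst s.2))
        rw [e1, e2] at this
        simpa using this
    refine (exec_seq_pure h2 (exec_pop _ _ _)).of_eq ?_
    rw [PMF.pure_map]
    congr 2
    funext r
    simp only [withCounters, Function.update_apply]
    split_ifs <;> simp_all

/-- A string of independent uniform bits is uniform. -/
theorem iterate_uniform (n : ℕ) (s : List Bool) :
    iterate (fun s => (PMF.uniformOfFintype Bool).map fun b => s ++ [b]) n s =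
      (PMF.uniformOfFintype (Bits n)).map fun u => s ++ List.ofFn u := by
  have key : ∀ n, PMF.uniformOfFintype (Bits (n + 1)) = (PMF.uniformOfFintype Bool).bind fun b =>
      (PMF.uniformOfFintype (Bits n)).map fun u => Fin.cons b u := by
    intro n
    ext u
    simp only [PMF.bind_apply, PMF.map_apply, PMF.uniformOfFintype_apply]
    -- Only one first bit and one tail produce `u`, and the weights multiply.
    rw [tsum_eq_single (u 0), tsum_eq_single (Fin.tail u)]
    · simp [Fin.cons_self_tail, pow_succ', ENNReal.mul_inv]
    · intro v hv
      rw [if_neg]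
      intro hu
      rw [hu] at hv
      simp at hv
    · intro b hb
      rw [ENNReal.tsum_eq_zero.2, mul_zero]
      intro v
      rw [if_neg]
      intro hu
      rw [hu] at hb
      simp at hb
  induction n generalizing s with
  | zero =>
    have : (fun u : Bits 0 => s ++ List.ofFn u) = Function.const _ s := by
      funext u; simp
    rw [this, PMF.map_const]
    rfl
  | succ n ih =>
    rw [key, PMF.map_bind]
    simp only [iterate, PMF.bind_map]
    congr 1
    funext b
    simp [ih, PMF.map_comp, Function.comp_def]

theorem exec_count_flip {dst : ℕ} (h : c ≠ tmp) (hcd : c ≠ dst) (htd : tmp ≠ dst)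
    (hc : ρ c = List.replicate n true) (ht : ρ tmp = []) (e : σ) :
    Exec O [forCount c tmp (.flip dst)] (n * 20 + 3) ρ e
      ((PMF.uniformOfFintype (Bits n)).map fun u =>
        (Function.update ρ dst (ρ dst ++ List.ofFn u), e)) := by
  have := exec_forCount (O := O) (body := .flip dst) (n := n) (T := 1) (α := List Bool)
    (f := fun s => (PMF.uniformOfFintype Bool).map fun b => s ++ [b])
    (reg := fun s => Function.update ρ dst s) (env := fun _ => e) h ?_
    (by simp [hcd, hc]) (by simp [htd, ht]) (ρ dst)
  · rw [Function.update_eq_self] at this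
    refine (this.mono (by omega)).of_eq ?_
    rw [iterate_uniform, PMF.map_comp]
    rfl
  · intro s i j
    refine (exec_flip _ _ _).of_eq ?_
    rw [PMF.map_comp]
    congr 1
    funext b
    simp only [Function.comp_apply, Prod.mk.injEq, and_true]
    funext r
    simp only [withCounters, Function.update_apply]
    split_ifs <;> simp_all

end

/-! ## Answering a query by a sequence of subqueries -/

theorem fit_length (n : ℕ) (s : List Bool) : (fit n s).length = n := List.takeD_length _ _ _

theorem fit_add (m n : ℕ) (s : List Bool) : fit (m + n) s = fit m s ++ fit n (s.drop m) := by
  induction m generalizing s with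
  | zero => simp [fit]
  | succ m ih =>
    rw [Nat.succ_add]
    cases s with
    | nil => simp [fit]
    | cons b s => simpa [fit] using ih s

theorem fit_of_length {n : ℕ} {s : List Bool} (h : s.length = n) : fit n s = s := by
  subst h
  simp [fit, List.takeD_eq_take]

theorem fit_fit (n : ℕ) (s : List Bool) : fit n (fit n s) = fit n s :=
  fit_of_length (fit_length n s)

/-- Registers `0, …, N - 1` hold `low`; the following ones hold two unary counters (with an empty
scratch register), a message, an output and a flag. -/
def layout (N : ℕ) (low : Regs) (k a : ℕ) (act out flag : List Bool) : Regs := fun r =>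
  if r < N then low r
  else if r = N then List.replicate k true
  else if r = N + 1 then List.replicate a true
  else if r = N + 2 then []
  else if r = N + 3 then act
  else if r = N + 4 then out
  else if r = N + 5 then flag
  else []

section Layout

variable (N : ℕ) (low : Regs) (k a : ℕ) (act out flag : List Bool)

theorem layout_of_lt {r : ℕ} (h : r < N) : layout N low k a act out flag r = low r := by
  simp [layout, h]

@[simp] theorem layout_counter : layout N low k a act out flag N = List.replicate k true := by
  simp [layout]

@[simp] theorem layout_counter' :
    layout N low k a act out flag (N + 1) = List.replicate a true := by
  simp [layout]

@[simp] theorem layout_scratch : layout N low k a act out flag (N + 2) = [] := by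
  simp [layout]

@[simp] theorem layout_act : layout N low k a act out flag (N + 3) = act := by
  simp [layout]

@[simp] theorem layout_out : layout N low k a act out flag (N + 4) = out := by
  simp [layout]

@[simp] theorem layout_flag : layout N low k a act out flag (N + 5) = flag := by
  simp [layout]

theorem update_layout_of_lt {r : ℕ} (h : r < N) (s : List Bool) :
    Function.update (layout N low k a act out flag) r s =
      layout N (Function.update low r s) k a act out flag := by
  funext i
  by_cases hi : i = r
  · subst hi; simp [layout, h]
  · simp [layout, hi]

@[simp] theorem update_layout_act (s : List Bool) :
    Function.update (layout N low k a act out flag) (N + 3) s = layout N low k a s out flag := by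
  funext i
  by_cases hi : i = N + 3
  · subst hi; simp
  · simp [layout, hi]

@[simp] theorem update_layout_out (s : List Bool) :
    Function.update (layout N low k a act out flag) (N + 4) s = layout N low k a act s flag := by
  funext i
  by_cases hi : i = N + 4
  · subst hi; simp
  · simp [layout, hi]

@[simp] theorem update_layout_flag (s : List Bool) :
    Function.update (layout N low k a act out flag) (N + 5) s = layout N low k a act out s := by
  funext i
  by_cases hi : i = N + 5
  · subst hi; simp
  · simp [layout, hi]

end Layout

/-- The last part of a subquery: a given message, the zero message, or a random message. -/
inductive Tail : Type
  | act : Tail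
  | zero : Tail
  | random : Tail

/-- A subquery (a constant followed by a message), or a placeholder for an absent one. -/
abbrev Slot : Type := Option (List Bool × Tail)

noncomputable section

/-- The distribution of the last part of a subquery. -/
def Tail.dist (k : ℕ) (act : List Bool) : Tail → PMF (List Bool)
  | .act => PMF.pure act
  | .zero => PMF.pure (List.replicate k false)
  | .random => (PMF.uniformOfFintype (Bits k)).map List.ofFn

/-- The distribution of a subquery. -/
def slotDist (k : ℕ) (act : List Bool) (p : List Bool × Tail) : PMF (List Bool) :=
  (p.2.dist k act).map fun u => p.1 ++ u

/-- Put subqueries with the given distributions one after the other, and collect the replies,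
cut or padded to length `w` and preceded by a presence bit. -/
def runPlan {τ : Type} (Q : Oracle τ) (w : ℕ) :
    List (Option (PMF (List Bool))) → τ → PMF (List Bool × τ)
  | [], t => PMF.pure ([], t)
  | none :: L, t => (runPlan Q w L t).map fun z => (List.replicate (1 + w) false ++ z.1, z.2)
  | some ν :: L, t => ν.bind fun s => (Q t s).bind fun y =>
      (runPlan Q w L y.2).map fun z => (true :: fit w y.1 ++ z.1, z.2)

end

/-- Append the last part of a subquery to register `0`. -/
def Tail.prog (N : ℕ) : Tail → Prog
  | .act => copyReg N (N + 2) (N + 3) 0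
  | .zero => forCount N (N + 2) (.push 0 false)
  | .random => forCount N (N + 2) (.flip 0)

/-- Put one subquery, by means of the program `sub`, and append the reply to the output. -/
def slotProg (N : ℕ) (sub : Prog) : Slot → Prog
  | none => .seq (.push (N + 4) false) (.seq (rep (.push (N + 4) false) mtu)
      (.seq (forCount N (N + 2) (.push (N + 4) false))
        (forCount (N + 1) (N + 2) (.push (N + 4) false))))
  | some p => .seq (pushAll 0 p.1) (.seq (p.2.prog N) (.seq sub (.seq (.push (N + 4) true)
      (.seq (rep (moveBit 0 (N + 4)) mtu) (.seq (forCount N (N + 2) (moveBit 0 (N + 4)))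
        (.seq (forCount (N + 1) (N + 2) (moveBit 0 (N + 4))) (clear 0)))))))

/-- Put several subqueries. -/
def slotsProg (N : ℕ) (sub : Prog) : List Slot → Prog
  | [] => .skip
  | p :: L => .seq (slotProg N sub p) (slotsProg N sub L)

/-- Answer the query in register `0`: its first `m` bits determine the subqueries, the following
`k` bits are a message for use in them. -/
def serve (N : ℕ) (sub : Prog) (m : ℕ) (plan : List Bool → List Slot) : Prog :=
  readThen 0 m fun w => .seq (forCount N (N + 2) (moveBit 0 (N + 3))) (.seq (clear 0)
    (.seq (slotsProg N sub (plan w)) (.seq (moveAll (N + 4) 0) (clear (N + 3)))))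

/-- The program `sub` implements the oracle `Q`, whose state is held in the registers below `N`
and in the environment, as long as the state is valid for a positive number of subqueries. -/
structure Implements {σ τ : Type} (O : Oracle σ) (sub : Prog) (Q : Oracle τ) (N k a len T Y : ℕ)
    (low : τ → Regs) (env : τ → σ) (valid : ℕ → τ → Prop) : Prop where
  exec : ∀ j t s act out flag, valid (j + 1) t → s.length = len →
    Exec O [sub] T (layout N (Function.update (low t) 0 s) k a act out flag) (env t)
      ((Q t s).map fun z =>
        (layout N (Function.update (low z.2) 0 z.1) k a act out flag, env z.2))
  reply : ∀ j t s, valid (j + 1) t → s.length = len → ∀ z ∈ (Q t s).support,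
    z.1.length ≤ Y ∧ valid j z.2
  skip : ∀ j t, valid (j + 1) t → valid j t

section

variable {τ : Type} {Q : Oracle τ}

theorem runPlan_length {w : ℕ} {L : List (Option (PMF (List Bool)))} {t : τ} :
    ∀ z ∈ (runPlan Q w L t).support, z.1.length = L.length * (1 + w) := by
  induction L generalizing t with
  | nil => simp [runPlan]
  | cons p L ih =>
    cases p with
    | none =>
      simp only [runPlan, PMF.mem_support_map_iff]
      rintro z ⟨y, hy, rfl⟩
      simp [ih y hy]
      ring
    | some ν =>
      simp only [runPlan, PMF.mem_support_map_iff, PMF.mem_support_bind_iff]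
      rintro z ⟨s, -, y, -, x, hx, rfl⟩
      simp [ih x hx, fit_length]
      ring

theorem slotDist_length {k : ℕ} {act : List Bool} (hact : act.length = k)
    (p : List Bool × Tail) : ∀ s ∈ (slotDist k act p).support, s.length = p.1.length + k := by
  obtain ⟨pre, tl⟩ := p
  simp only [slotDist, PMF.mem_support_map_iff]
  rintro s ⟨u, hu, rfl⟩
  cases tl <;> simp only [Tail.dist, PMF.mem_support_pure_iff, PMF.mem_support_map_iff] at hu
  · simp [hu, hact]
  · simp [hu]
  · obtain ⟨v, -, rfl⟩ := hu
    simp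

variable {σ : Type} {O : Oracle σ} {N k a : ℕ}

theorem exec_tail (hN : 0 < N) (tl : Tail) (low : Regs) (act out flag s : List Bool) (e : σ)
    (hact : act.length = k) :
    Exec O [tl.prog N] (k * 20 + 3) (layout N (Function.update low 0 s) k a act out flag) e
      ((tl.dist k act).map fun u =>
        (layout N (Function.update low 0 (s ++ u)) k a act out flag, e)) := by
  cases tl with
  | act =>
    refine (exec_copyReg (n := k) (by omega) (by omega) (by omega) (by omega) (by omega)
      (by omega) (by simp) (by simp) (by simpa using hact) e).of_eq ?_
    simp [Tail.dist, PMF.pure_map, update_layout_of_lt, layout_of_lt, hN]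
  | zero =>
    refine (exec_count_push (n := k) (by omega) (by omega) (by omega)
      (by simp) (by simp) _ e).of_eq ?_
    simp [Tail.dist, PMF.pure_map, update_layout_of_lt, layout_of_lt, hN]
  | random =>
    refine (exec_count_flip (n := k) (by omega) (by omega) (by omega)
      (by simp) (by simp) e).of_eq ?_
    simp [Tail.dist, PMF.map_comp, Function.comp_def, update_layout_of_lt, layout_of_lt, hN]

/-- A bound for the running time of a subquery. -/
def slotTime (k a c T Y : ℕ) : ℕ := 2 * c + 5 * mtu + 40 * k + 20 * a + T + 2 * Y + 30

/-- The width `mtu + k + a` is the length of a trapdoor when `a` is the ciphertext length of `Sym`.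
Only `mtu` is a constant that can be repeated in the program text; `k` and `a` come from the unary
counters. -/
theorem exec_slot_none (T Y c : ℕ) (low : Regs) (act out flag : List Bool) (sub : Prog) (e : σ) :
    Exec O [slotProg N sub none] (slotTime k a c T Y) (layout N low k a act out flag) e
      (PMF.pure (layout N low k a act
        (out ++ List.replicate (1 + (mtu + k + a)) false) flag, e)) := by
  refine Exec.mono (n := 1 + ((2 * mtu + 1) + ((k * 20 + 3) + (a * 20 + 3) + 1) + 1) + 1) ?_
    (by unfold slotTime; omega)
  refine exec_seq_pure (exec_push _ _ _ _) (exec_seq_pure (exec_rep_push _ _ _ _ _)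
    (exec_seq_pure (exec_count_push (n := k) (by omega) (by omega) (by omega)
      (by simp) (by simp) _ e) ((exec_count_push (n := a) (by omega) (by omega) (by omega)
      (by simp) (by simp) _ e).of_eq ?_)))
  rw [Nat.add_comm 1, List.replicate_succ]
  simp [add_assoc]

variable {len T Y c : ℕ} {sub : Prog} {low : τ → Regs} {env : τ → σ} {valid : ℕ → τ → Prop}

theorem exec_slot_some (hN : 0 < N)
    (h : Implements O sub Q N k a (c + k) T Y low env valid)
    (p : List Bool × Tail) (hp : p.1.length = c) {j : ℕ} {t : τ} (ht : valid (j + 1) t)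
    {act : List Bool} (hact : act.length = k) (out flag : List Bool) :
    Exec O [slotProg N sub (some p)] (slotTime k a c T Y)
      (layout N (Function.update (low t) 0 []) k a act out flag) (env t)
      (((slotDist k act p).bind (Q t)).map fun z =>
        (layout N (Function.update (low z.2) 0 []) k a act
          (out ++ true :: fit (mtu + k + a) z.1) flag, env z.2)) := by
  have hlen := slotDist_length hact p
  obtain ⟨pre, tl⟩ := p
  change pre.length = c at hp
  subst hp
  refine Exec.mono (n := (2 * pre.length + 1) + ((k * 20 + 3) + (T + (1 + ((5 * mtu + 1) +
    ((k * 20 + 3) + ((a * 20 + 3) + (2 * Y + 1) + 1) + 1) + 1) + 1) + 1) + 1) + 1) ?_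
    (by unfold slotTime; omega)
  have e1 := exec_pushAll (O := O) 0 pre
    (layout N (Function.update (low t) 0 []) k a act out flag) (env t)
  rw [update_layout_of_lt _ _ _ _ _ _ _ hN, layout_of_lt _ _ _ _ _ _ _ hN,
    Function.update_idem, Function.update_self, List.nil_append] at e1
  refine exec_seq_pure e1 ?_
  refine Exec.of_eq (μ := (tl.dist k act).bind fun u => (Q t (pre ++ u)).bind fun z =>
    PMF.pure (layout N (Function.update (low z.2) 0 []) k a act
          (out ++ true :: fit (mtu + k + a) z.1) flag, env z.2)) ?_
    (by simp only [slotDist, PMF.bind_map, PMF.map_bind]; rfl)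
  refine exec_seq_map (exec_tail hN tl (low t) act out flag pre (env t) hact) fun u hu => ?_
  have hs : (pre ++ u).length = pre.length + k :=
    hlen _ ((PMF.mem_support_map_iff _ _ _).2 ⟨u, hu, rfl⟩)
  refine exec_seq_map (h.exec j t (pre ++ u) act out flag ht hs) fun z hz => ?_
  -- This bounds the cost of deleting what remains of the reply after `mtu + k + a` bits have been
  -- moved.
  have hY := (h.reply j t (pre ++ u) ht hs z hz).1
  refine exec_seq_pure (exec_push _ _ _ _) (exec_seq_pure
    (exec_rep_moveBit (by omega) _ _ _) (exec_seq_pure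
    (exec_count_moveBit (n := k) (by omega) (by omega) (by omega) (by omega) (by omega) (by omega)
      ?_ ?_ _) (exec_seq_pure
    (exec_count_moveBit (n := a) (by omega) (by omega) (by omega) (by omega) (by omega) (by omega)
      ?_ ?_ _) (((exec_clear _ _ _).mono ?_).of_eq ?_))))
  all_goals simp only [update_layout_out, update_layout_of_lt _ _ _ _ _ _ _ hN,
    layout_of_lt _ _ _ _ _ _ _ hN, layout_counter, layout_counter', layout_scratch,
    layout_out, Function.update_idem, Function.update_self, List.drop_drop]
  · simp only [List.length_drop]
    omega
  · rw [fit_add, fit_add]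
    simp

theorem exec_slots (hN : 0 < N)
    (h : Implements O sub Q N k a (c + k) T Y low env valid)
    (L : List Slot) (hL : ∀ p, some p ∈ L → p.1.length = c) {t : τ} (ht : valid L.length t)
    {act : List Bool} (hact : act.length = k) (out flag : List Bool) :
    Exec O [slotsProg N sub L] (L.length * (slotTime k a c T Y + 1) + 1)
      (layout N (Function.update (low t) 0 []) k a act out flag) (env t)
      ((runPlan Q (mtu + k + a) (L.map (Option.map (slotDist k act))) t).map fun z =>
        (layout N (Function.update (low z.2) 0 []) k a act (out ++ z.1) flag, env z.2)) := by
  induction L generalizing t out with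
  | nil => exact Exec.of_eq ((exec_skip _ _).mono (by omega)) (by simp [runPlan, PMF.pure_map])
  | cons p L ih =>
    rw [List.length_cons] at ht
    have hL' : ∀ p, some p ∈ L → p.1.length = c := fun p hp => hL p (List.mem_cons_of_mem _ hp)
    refine Exec.mono (n := slotTime k a c T Y + (L.length * (slotTime k a c T Y + 1) + 1) + 1) ?_
      (by rw [List.length_cons]; ring_nf; omega)
    cases p with
    | none =>
      refine (exec_seq_pure (exec_slot_none _ _ _ _ _ _ _ _ _)
        (ih hL' (h.skip _ _ ht) _)).of_eq ?_
      simp [runPlan, PMF.map_comp, Function.comp_def]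
    | some p =>
      refine (exec_seq_map (exec_slot_some hN h p (hL p (by simp)) ht hact out flag)
        (ν := fun z => (runPlan Q (mtu + k + a) (L.map (Option.map (slotDist k act))) z.2).map
          fun y => (layout N (Function.update (low y.2) 0 []) k a act
            (out ++ true :: fit (mtu + k + a) z.1 ++ y.1) flag, env y.2)) ?_).of_eq ?_
      · intro z hz
        obtain ⟨s, hs, hz⟩ := (PMF.mem_support_bind_iff _ _ _).1 hz
        have hl := slotDist_length hact p s hs
        rw [hL p (by simp)] at hl
        exact ih hL' (h.reply _ t s ht hl z hz).2 _
      · simp [runPlan, PMF.map_bind, PMF.map_comp, Function.comp_def, PMF.bind_bind]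

theorem runPlan_valid (h : Implements O sub Q N k a (c + k) T Y low env valid)
    (L : List Slot) (hL : ∀ p, some p ∈ L → p.1.length = c) {t : τ} (ht : valid L.length t)
    {act : List Bool} (hact : act.length = k) {w : ℕ} :
    ∀ z ∈ (runPlan Q w (L.map (Option.map (slotDist k act))) t).support, valid 0 z.2 := by
  induction L generalizing t with
  | nil => simpa [runPlan] using ht
  | cons p L ih =>
    rw [List.length_cons] at ht
    have hL' : ∀ p, some p ∈ L → p.1.length = c := fun p hp => hL p (List.mem_cons_of_mem _ hp)
    cases p with
    | none =>
      simp only [List.map_cons, Option.map_none, runPlan, PMF.mem_support_map_iff]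
      rintro z ⟨y, hy, rfl⟩
      exact ih hL' (h.skip _ _ ht) y hy
    | some p =>
      simp only [List.map_cons, Option.map_some, runPlan, PMF.mem_support_map_iff,
        PMF.mem_support_bind_iff]
      rintro z ⟨s, hs, y, hy, x, hx, rfl⟩
      have hl := slotDist_length hact p s hs
      rw [hL p (by simp)] at hl
      exact ih hL' (h.reply _ t s ht hl y hy).2 x hx

/-- A bound for the time needed to answer a query of length at most `l` by `n` subqueries. -/
def serveTime (k a c T Y m l n : ℕ) : ℕ :=
  3 * m + 22 * k + 2 * l + n * (slotTime k a c T Y + 1) + 5 * (n * (1 + (mtu + k + a))) + 20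

/-- The first `m` bits select a branch in which the plan is already evaluated, so decoding rules or
leakages needs no code of its own. The message is set aside in register `N + 3`, where every
subquery can copy it. The bound `l` on the query's length pays for deleting the unread rest. -/
theorem exec_serve (hN : 0 < N) (h : Implements O sub Q N k a (c + k) T Y low env valid)
    {m l n : ℕ} {plan : List Bool → List Slot} (hn : ∀ w, (plan w).length = n)
    (hc : ∀ w p, some p ∈ plan w → p.1.length = c) {t : τ} (ht : valid n t) {s : List Bool}
    (hs : s.length ≤ l) (flag : List Bool) :
    Exec O [serve N sub m plan] (serveTime k a c T Y m l n)
      (layout N (Function.update (low t) 0 s) k a [] [] flag) (env t)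
      ((runPlan Q (mtu + k + a) ((plan (fit m s)).map
          (Option.map (slotDist k (fit k (s.drop m))))) t).map fun z =>
        (layout N (Function.update (low z.2) 0 z.1) k a [] [] flag, env z.2)) := by
  refine Exec.mono (n := 3 * m + ((k * 20 + 3) + ((2 * l + 1) +
    ((n * (slotTime k a c T Y + 1) + 1) + ((5 * (n * (1 + (mtu + k + a))) + 1) + (2 * k + 1) + 1)
      + 1) + 1) + 1)) ?_ (by unfold serveTime; omega)
  refine exec_readThen ?_
  rw [update_layout_of_lt _ _ _ _ _ _ _ hN, layout_of_lt _ _ _ _ _ _ _ hN,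
    Function.update_idem, Function.update_self]
  refine exec_seq_pure (exec_count_moveBit (n := k) (by omega) (by omega) (by omega) (by omega)
    (by omega) (by omega) (by simp) (by simp) _) (exec_seq_pure ((exec_clear _ _ _).mono ?_) ?_)
  · simp only [update_layout_act, update_layout_of_lt _ _ _ _ _ _ _ hN,
      layout_of_lt _ _ _ _ _ _ _ hN, Function.update_self, List.length_drop]
    omega
  simp only [update_layout_act, update_layout_of_lt _ _ _ _ _ _ _ hN, layout_act, List.nil_append,
      layout_of_lt _ _ _ _ _ _ _ hN, Function.update_self, Function.update_idem]
  have e1 := exec_slots hN h (plan (fit m s)) (hc _) (t := t) (by rwa [hn])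
    (fit_length k (s.drop m)) [] flag
  rw [hn] at e1
  refine (exec_seq_map e1 (ν := fun z => PMF.pure
    (layout N (Function.update (low z.2) 0 z.1) k a [] [] flag, env z.2)) ?_).of_eq rfl
  intro z hz
  have hl := runPlan_length z hz
  rw [List.length_map, hn] at hl
  refine exec_seq_pure ((exec_moveAll (by omega) _ _).mono ?_)
    (((exec_clear _ _ _).mono ?_).of_eq ?_)
  all_goals simp only [update_layout_act, update_layout_out, update_layout_of_lt _ _ _ _ _ _ _ hN,
      layout_act, layout_out, List.nil_append, fit_length,
      layout_of_lt _ _ _ _ _ _ _ hN, Function.update_self, Function.update_idem, le_refl]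
  rw [hl]

end

/-! ## Programs in larger register files -/

/-- All registers that a program uses have smaller numbers than this. -/
def Prog.bound : Prog → ℕ
  | .skip => 1
  | .push r _ => r + 1
  | .pop r => r + 1
  | .flip r => r + 1
  | .seq p q => max p.bound q.bound
  | .ite r p q => max (r + 1) (max p.bound q.bound)
  | .loop r p => max (r + 1) p.bound
  | .call => 1

section

variable {σ : Type} {O : Oracle σ}

theorem step_bound {t : List Prog} {ρ : Regs} {e : σ} {N : ℕ} (ht : ∀ p ∈ t, p.bound ≤ N) :
    ∀ c ∈ (step O ⟨t, ρ, e⟩).support, ∀ p ∈ c.todo, p.bound ≤ N := by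
  intro c hc
  match t, ht with
  | [], ht => simp_all [step]
  | .skip :: t, ht => simp_all [step]
  | .push r b :: t, ht => simp_all [step]
  | .pop r :: t, ht => simp_all [step]
  | .flip r :: t, ht =>
    simp only [step, PMF.mem_support_map_iff] at hc
    obtain ⟨b, -, rfl⟩ := hc
    simp_all
  | .seq p q :: t, ht => simp_all [step, Prog.bound]
  | .ite r p q :: t, ht =>
    simp only [step, PMF.mem_support_pure_iff] at hc
    subst hc
    simp only [List.mem_cons, forall_eq_or_imp, Prog.bound] at ht ⊢
    refine ⟨?_, ht.2⟩
    split_ifs <;> omega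
  | .loop r p :: t, ht =>
    simp only [step, PMF.mem_support_pure_iff] at hc
    subst hc
    simp only [List.mem_cons, forall_eq_or_imp, Prog.bound] at ht ⊢
    split_ifs
    · exact ht.2
    · simp only [List.mem_cons, forall_eq_or_imp, Prog.bound]
      exact ⟨by omega, ht⟩
  | .call :: t, ht =>
    simp only [step, PMF.mem_support_map_iff] at hc
    obtain ⟨b, -, rfl⟩ := hc
    simp_all

/-- Only pushes, coin flips and replies lengthen a register. This limits the queries of a
time-bounded adversary and the output of a time-bounded simulator. -/
theorem step_length {Y : ℕ} (hO : ∀ e q, ∀ y ∈ (O e q).support, y.1.length ≤ Y)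
    {t : List Prog} {ρ : Regs} {e : σ} (r : ℕ) :
    ∀ c ∈ (step O ⟨t, ρ, e⟩).support, (c.regs r).length ≤ max (ρ r).length Y + 1 := by
  intro c hc
  have hup : ∀ (r' : ℕ) (s : List Bool), s.length ≤ max (ρ r').length Y + 1 →
      (Function.update ρ r' s r).length ≤ max (ρ r).length Y + 1 := by
    intro r' s hs
    by_cases h : r = r'
    · subst h; simpa using hs
    · rw [Function.update_of_ne h]; omega
  match t with
  | [] => simp_all [step]; omega
  | .skip :: t => simp_all [step]; omega
  | .push r' b :: t =>
    simp only [step, PMF.mem_support_pure_iff] at hc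
    subst hc
    exact hup _ _ (by simp)
  | .pop r' :: t =>
    simp only [step, PMF.mem_support_pure_iff] at hc
    subst hc
    exact hup _ _ (by simp; omega)
  | .flip r' :: t =>
    simp only [step, PMF.mem_support_map_iff] at hc
    obtain ⟨b, -, rfl⟩ := hc
    exact hup _ _ (by simp)
  | .seq p q :: t => simp_all [step]; omega
  | .ite r p q :: t => simp_all [step]; omega
  | .loop r p :: t => simp_all [step]; omega
  | .call :: t =>
    simp only [step, PMF.mem_support_map_iff] at hc
    obtain ⟨b, hb, rfl⟩ := hc
    exact hup _ _ (by have := hO _ _ b hb; omega)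

theorem runFor_length {Y : ℕ} (hO : ∀ e q, ∀ y ∈ (O e q).support, y.1.length ≤ Y) (r n : ℕ)
    (c : Config σ) : ∀ d ∈ (runFor O n c).support, (d.regs r).length ≤ max (c.regs r).length Y + n := by
  induction n generalizing c with
  | zero => simp [runFor]
  | succ n ih =>
    intro d hd
    obtain ⟨c', hc', hd⟩ := (PMF.mem_support_bind_iff _ _ _).1 hd
    have h1 := step_length hO r c' hc'
    have h2 := ih c' d hd
    omega

/-- A program that mentions only registers below `N` neither reads nor changes the counters and
buffers above them. -/
theorem step_layout {t : List Prog} {N : ℕ} (hN : 0 < N) (ht : ∀ p ∈ t, p.bound ≤ N)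
    (low : Regs) (e : σ) (k a : ℕ) (act out flag : List Bool) :
    step O ⟨t, layout N low k a act out flag, e⟩ = (step O ⟨t, low, e⟩).map fun c =>
      ⟨c.todo, layout N c.regs k a act out flag, c.env⟩ := by
  match t, ht with
  | [], ht => simp [step, PMF.pure_map]
  | .skip :: t, ht => simp [step, PMF.pure_map]
  | .push r b :: t, ht =>
    have hr : r < N := ht (.push r b) (by simp)
    simp [step, PMF.pure_map, update_layout_of_lt, layout_of_lt, hr]
  | .pop r :: t, ht =>
    have hr : r < N := ht (.pop r) (by simp)
    simp [step, PMF.pure_map, update_layout_of_lt, layout_of_lt, hr]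
  | .flip r :: t, ht =>
    have hr : r < N := ht (.flip r) (by simp)
    simp [step, PMF.map_comp, Function.comp_def, update_layout_of_lt, layout_of_lt, hr]
  | .seq p q :: t, ht => simp [step, PMF.pure_map]
  | .ite r p q :: t, ht =>
    have hr : r < N := (le_max_left _ _).trans (ht (.ite r p q) (by simp))
    simp [step, PMF.pure_map, layout_of_lt, hr]
  | .loop r p :: t, ht =>
    have hr : r < N := (le_max_left _ _).trans (ht (.loop r p) (by simp))
    simp [step, PMF.pure_map, layout_of_lt, hr]
  | .call :: t, ht =>
    simp [step, PMF.map_comp, Function.comp_def, update_layout_of_lt, layout_of_lt, hN]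

theorem runFor_layout {N : ℕ} (hN : 0 < N) (n k a : ℕ) (act out flag : List Bool)
    (c : Config σ) (ht : ∀ p ∈ c.todo, p.bound ≤ N) :
    runFor O n ⟨c.todo, layout N c.regs k a act out flag, c.env⟩ = (runFor O n c).map fun c =>
      ⟨c.todo, layout N c.regs k a act out flag, c.env⟩ := by
  induction n generalizing c with
  | zero => simp [runFor, PMF.pure_map]
  | succ n ih =>
    simp only [runFor, step_layout hN ht, PMF.bind_map, PMF.map_bind]
    exact pmf_bind_congr fun d hd => ih d (step_bound ht d hd)

theorem Exec.layout {N n : ℕ} {t : List Prog} {low : Regs} {e : σ} {μ : PMF (Regs × σ)}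
    (h : Exec O t n low e μ) (hN : 0 < N) (ht : ∀ p ∈ t, p.bound ≤ N) (k a : ℕ)
    (act out flag : List Bool) :
    Exec O t n (layout N low k a act out flag) e
      (μ.map fun x => (PatternMatching.layout N x.1 k a act out flag, x.2)) := by
  unfold Exec at *
  rw [runFor_layout hN n k a act out flag ⟨t, low, e⟩ ht, h, PMF.map_comp, PMF.map_comp]
  rfl

/-- Save the two public parameters. -/
def saveParams (N : ℕ) : Prog :=
  .seq (forCount 0 (N + 2) (.push N true)) (forCount 1 (N + 2) (.push (N + 1) true))

/-- `forCount` restores its counter, so the hosted program still finds its initial registers, while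
the copies survive whatever it does to registers `0` and `1`. -/
theorem exec_saveParams {N : ℕ} (hN : 2 ≤ N) (k a : ℕ) (e : σ) :
    Exec O [saveParams N] (20 * k + 20 * a + 7) (initRegs k a) e
      (PMF.pure (layout N (initRegs k a) k a [] [] [], e)) := by
  have h0 : ∀ r, 2 ≤ r → initRegs k a r = [] := by
    intro r hr
    obtain ⟨r, rfl⟩ := Nat.exists_eq_add_of_le' hr
    rfl
  refine Exec.mono (n := (k * 20 + 3) + (a * 20 + 3) + 1) (exec_seq_pure
    (exec_count_push (n := k) (by omega) (by omega) (by omega) rfl (h0 _ (by omega)) _ e)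
    ((exec_count_push (n := a) (by omega) (by omega) (by omega) ?_ ?_ _ e).of_eq ?_)) (by omega)
  · rw [Function.update_of_ne (by omega)]; rfl
  · rw [Function.update_of_ne (by omega)]; exact h0 _ (by omega)
  · congr 2
    funext r
    simp only [Function.update_apply, layout]
    have h1 := h0 N (by omega)
    have h2 := h0 (N + 1) (by omega)
    split_ifs <;> first | omega | exact h0 _ (by omega) | simp_all

end

/-! ## Replacing the oracle calls of a program -/

/-- Replace the oracle calls by runs of `h`. -/
def replaceCall (h : Prog) : Prog → Prog
  | .seq p q => .seq (replaceCall h p) (replaceCall h q)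
  | .ite r p q => .ite r (replaceCall h p) (replaceCall h q)
  | .loop r p => .loop r (replaceCall h p)
  | .call => h
  | p => p

/-- The oracle that passes the first query on, and answers the following ones by means of several
subqueries. -/
noncomputable def planOracle {σ : Type} (O : Oracle σ) (k a m : ℕ)
    (plan : List Bool → List Slot) : Oracle (Bool × σ)
  | (false, e), x => (O e x).map fun y => (y.1, (true, y.2))
  | (true, e), s => (runPlan O (mtu + k + a) ((plan (fit m s)).map
      (Option.map (slotDist k (fit k (s.drop m))))) e).map fun z => (z.1, (true, z.2))

/-- The program for `planOracle`. -/
def handler (N m : ℕ) (plan : List Bool → List Slot) : Prog :=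
  .ite (N + 5) (serve N .call m plan) (.seq (.push (N + 5) true) .call)

/-- The register that tells whether the first query has been made. -/
def flagReg : Bool → List Bool
  | false => []
  | true => [true]

section

variable {σ : Type} {O : Oracle σ} {N k a m n c Y : ℕ} {plan : List Bool → List Slot}

theorem implements_call (hN : 0 < N) (hO : ∀ e q, ∀ y ∈ (O e q).support, y.1.length ≤ Y)
    (low : Regs) : Implements O .call O N k a (c + k) 1 Y (fun _ => low) id fun _ _ => True where
  exec j e s act out flag _ _ := by
    refine (exec_call _ _).of_eq ?_
    simp [update_layout_of_lt, layout_of_lt, hN]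
  reply j e s _ _ z hz := ⟨hO _ _ z hz, trivial⟩
  skip _ _ _ := trivial

theorem planOracle_length (hO : ∀ e q, ∀ y ∈ (O e q).support, y.1.length ≤ Y)
    (hn : ∀ w, (plan w).length = n) : ∀ e q, ∀ y ∈ (planOracle O k a m plan e q).support,
      y.1.length ≤ max Y (n * (1 + (mtu + k + a))) := by
  rintro ⟨f, e⟩ q y hy
  cases f
  · obtain ⟨z, hz, rfl⟩ := (PMF.mem_support_map_iff _ _ _).1 hy
    exact (hO _ _ z hz).trans (le_max_left _ _)
  · obtain ⟨z, hz, rfl⟩ := (PMF.mem_support_map_iff _ _ _).1 hy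
    have := runPlan_length z hz
    simp only [List.length_map, hn] at this
    exact this.le.trans (le_max_right _ _)

/-- A bound for the time needed to handle an oracle call. -/
def handlerTime (k a c Y m l n : ℕ) : ℕ := serveTime k a c 1 Y m l n + 5

theorem exec_handler (hN : 0 < N) (hO : ∀ e q, ∀ y ∈ (O e q).support, y.1.length ≤ Y)
    (hn : ∀ w, (plan w).length = n) (hc : ∀ w p, some p ∈ plan w → p.1.length = c)
    (low : Regs) {l : ℕ} (hl : (low 0).length ≤ l) (f : Bool) (e : σ) :
    Exec O [handler N m plan] (handlerTime k a c Y m l n)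
      (layout N low k a [] [] (flagReg f)) e
      ((planOracle O k a m plan (f, e) (low 0)).map fun z =>
        (layout N (Function.update low 0 z.1) k a [] [] (flagReg z.2.1), z.2.2)) := by
  cases f with
  | true =>
    refine Exec.mono (n := serveTime k a c 1 Y m l n + 1) (exec_ite ?_)
      (by unfold handlerTime; omega)
    have := exec_serve (m := m) hN (implements_call (k := k) (a := a) (c := c) hN hO low) hn hc (t := e) trivial hl
      (flagReg true)
    rw [Function.update_eq_self] at this
    simp only [layout_flag]
    simpa [flagReg, planOracle, PMF.map_comp, Function.comp_def] using this
  | false =>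
    refine Exec.mono (n := 3 + 1) (exec_ite ?_) (by unfold handlerTime; omega)
    simp only [layout_flag]
    refine exec_seq_pure (n := 1) (m := 1) (exec_push _ _ _ _) ((exec_call _ _).of_eq ?_)
    simp [flagReg, planOracle, PMF.map_comp, Function.comp_def, update_layout_of_lt,
      layout_of_lt, hN]

/-- Apart from oracle calls, the original and the transformed program move in lockstep, one step for
one step. -/
theorem step_replaceCall {h p : Prog} {t : List Prog} {O' : Oracle (Bool × σ)}
    (hp : p.bound ≤ N) (hp' : p ≠ .call) (ρ : Regs) (e : Bool × σ) :
    step O ⟨(p :: t).map (replaceCall h), layout N ρ k a [] [] (flagReg e.1), e.2⟩ =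
      (step O' ⟨p :: t, ρ, e⟩).map fun c => ⟨c.todo.map (replaceCall h),
        layout N c.regs k a [] [] (flagReg c.env.1), c.env.2⟩ := by
  cases p with
  | skip => simp [step, PMF.pure_map, replaceCall]
  | push r b =>
    have hr : r < N := hp
    simp [step, PMF.pure_map, replaceCall, update_layout_of_lt, layout_of_lt, hr]
  | pop r =>
    have hr : r < N := hp
    simp [step, PMF.pure_map, replaceCall, update_layout_of_lt, layout_of_lt, hr]
  | flip r =>
    have hr : r < N := hp
    simp [step, PMF.map_comp, Function.comp_def, replaceCall, update_layout_of_lt,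
      layout_of_lt, hr]
  | seq p q => simp [step, PMF.pure_map, replaceCall]
  | ite r p q =>
    have hr : r < N := (le_max_left _ _).trans hp
    simp only [step, PMF.pure_map, replaceCall, layout_of_lt _ _ _ _ _ _ _ hr, List.map_cons]
    split_ifs <;> rfl
  | loop r p =>
    have hr : r < N := (le_max_left _ _).trans hp
    simp only [step, PMF.pure_map, replaceCall, layout_of_lt _ _ _ _ _ _ _ hr, List.map_cons]
    split_ifs <;> rfl
  | call => exact absurd rfl hp'

/-- Each of the `T` steps of the original becomes either one step or one run of the handler. The
budget `l` for the length of a query survives the induction because register `0` grows by at most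
one bit beyond `max _ Y'` per step, with `Y'` the bound on replies, while `T` drops by one. -/
theorem exec_replaceCall (hN : 0 < N) (hO : ∀ e q, ∀ y ∈ (O e q).support, y.1.length ≤ Y)
    (hn : ∀ w, (plan w).length = n) (hc : ∀ w p, some p ∈ plan w → p.1.length = c) {l : ℕ}
    (T : ℕ) (cfg : Config (Bool × σ)) (ht : ∀ p ∈ cfg.todo, p.bound ≤ N)
    (hl : max (cfg.regs 0).length (max Y (n * (1 + (mtu + k + a)))) + T ≤ l)
    (hh : HaltsIn (planOracle O k a m plan) T cfg) :
    Exec O (cfg.todo.map (replaceCall (handler N m plan))) (T * handlerTime k a c Y m l n)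
      (layout N cfg.regs k a [] [] (flagReg cfg.env.1)) cfg.env.2
      ((outcome (planOracle O k a m plan) T cfg).map fun x =>
        (layout N x.1 k a [] [] (flagReg x.2.1), x.2.2)) := by
  induction T generalizing cfg with
  | zero =>
    have h0 : cfg.todo = [] := hh cfg (by simp [runFor])
    rw [h0]
    exact (exec_nil _ _).of_eq (by simp [outcome, runFor, PMF.pure_map])
  | succ T ih =>
    obtain ⟨t, ρ, e⟩ := cfg
    have key : ∀ d ∈ (step (planOracle O k a m plan) ⟨t, ρ, e⟩).support,
        Exec O (d.todo.map (replaceCall (handler N m plan))) (T * handlerTime k a c Y m l n)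
          (layout N d.regs k a [] [] (flagReg d.env.1)) d.env.2
          ((outcome (planOracle O k a m plan) T d).map fun x =>
            (layout N x.1 k a [] [] (flagReg x.2.1), x.2.2)) := by
      intro d hd
      refine ih d (step_bound ht d hd) ?_ fun x hx =>
        hh x ((PMF.mem_support_bind_iff _ _ _).2 ⟨d, hd, hx⟩)
      have := step_length (planOracle_length hO hn) 0 d hd
      simp only at hl
      omega
    have hout : outcome (planOracle O k a m plan) (T + 1) ⟨t, ρ, e⟩ =
        (step (planOracle O k a m plan) ⟨t, ρ, e⟩).bind
          fun d => outcome (planOracle O k a m plan) T d := by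
      simp only [outcome, runFor, PMF.map_bind]
    rw [hout, PMF.map_bind]
    cases t with
    | nil =>
      refine (exec_nil _ _).of_eq ?_
      simp [step, outcome, runFor_nil, PMF.pure_map]
    | cons p t =>
      by_cases hp : p = .call
      · subst hp
        simp only [step, PMF.bind_map]
        refine Exec.mono (n := handlerTime k a c Y m l n + T * handlerTime k a c Y m l n) ?_
          (by ring_nf; omega)
        have h1 := exec_handler (k := k) (a := a) (m := m) hN hO hn hc ρ (l := l)
          (by simp only at hl; omega) e.1 e.2
        have h2 : ∀ x ∈ (planOracle O k a m plan e (ρ 0)).support, _ := fun x hx =>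
          key ⟨t, Function.update ρ 0 x.1, x.2⟩
            (by simp only [step, PMF.mem_support_map_iff]; exact ⟨x, hx, rfl⟩)
        have h3 := exec_append (t := t.map (replaceCall (handler N m plan))) h1
          (m := T * handlerTime k a c Y m l n)
          (ν := fun x => outcome O (T * handlerTime k a c Y m l n)
            ⟨t.map (replaceCall (handler N m plan)), x.1, x.2⟩) ?_
        · refine Exec.of_eq (t := [_] ++ _) h3 ?_
          rw [PMF.bind_map]
          exact pmf_bind_congr fun x hx => (h2 x hx).outcome_eq
        · intro y hy
          obtain ⟨x, hx, rfl⟩ := (PMF.mem_support_map_iff _ _ _).1 hy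
          exact (h2 x hx).haltsIn.exec
      · refine Exec.mono (n := T * handlerTime k a c Y m l n + 1) ?_
          (by unfold handlerTime; ring_nf; omega)
        unfold Exec at key ⊢
        simp only [runFor]
        rw [step_replaceCall (O' := planOracle O k a m plan) (ht p (by simp)) hp, PMF.bind_map,
          PMF.map_bind]
        exact pmf_bind_congr key

end

/-! ## Comparing oracles -/

/-- Oracles whose replies can be coupled are not told apart. -/
theorem output_congr {σ τ : Type} {O : Oracle σ} {O' : Oracle τ} (R : σ → τ → Prop)
    (h : ∀ e e', R e e' → ∀ q, ∃ μ : PMF (List Bool × σ × τ),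
      O e q = μ.map (fun x => (x.1, x.2.1)) ∧ O' e' q = μ.map (fun x => (x.1, x.2.2)) ∧
        ∀ x ∈ μ.support, R x.2.1 x.2.2)
    (A : Adversary) (k a : ℕ) {e : σ} {e' : τ} (he : R e e') :
    A.output k a O e = A.output k a O' e' := by
  -- The oracle states have different types, so only the laws of the registers are compared; a call
  -- is the only step at which the coupling is used.
  have key : ∀ n t ρ e e', R e e' → (runFor O n ⟨t, ρ, e⟩).map Config.regs =
      (runFor O' n ⟨t, ρ, e'⟩).map Config.regs := by
    intro n
    induction n with
    | zero => intro t ρ e e' _; simp [runFor, PMF.pure_map]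
    | succ n ih =>
      intro t ρ e e' he
      simp only [runFor, PMF.map_bind]
      match t with
      | [] => simp [step, ih _ _ _ _ he]
      | .skip :: t => simp [step, ih _ _ _ _ he]
      | .push r b :: t => simp [step, ih _ _ _ _ he]
      | .pop r :: t => simp [step, ih _ _ _ _ he]
      | .flip r :: t => simp [step, ih _ _ _ _ he, PMF.bind_map, Function.comp_def]
      | .seq p q :: t => simp [step, ih _ _ _ _ he]
      | .ite r p q :: t => simp [step, ih _ _ _ _ he]
      | .loop r p :: t => simp [step, ih _ _ _ _ he]
      | .call :: t =>
        obtain ⟨μ, h1, h2, h3⟩ := h e e' he (ρ 0)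
        simp only [step, h1, h2, PMF.bind_map, Function.comp_def]
        exact pmf_bind_congr fun x hx => ih _ _ _ _ (h3 x hx)
  have := congrArg (PMF.map fun ρ : Regs => (ρ 0).headD false)
    (key (A.time.eval k) [A.prog] (initRegs k a) e e' he)
  rw [PMF.map_comp, PMF.map_comp] at this
  exact this

/-! ## Polynomial bounds -/

/-- Functions bounded by a polynomial. -/
def PolyBounded (f : ℕ → ℕ) : Prop := ∃ p : Polynomial ℕ, ∀ k, f k ≤ p.eval k

theorem eval_mono (p : Polynomial ℕ) : Monotone fun k => p.eval k := by
  intro j k h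
  simp only [Polynomial.eval_eq_sum_range]
  gcongr

theorem PolyBounded.eval (p : Polynomial ℕ) : PolyBounded fun k => p.eval k := ⟨p, fun _ => le_rfl⟩

theorem PolyBounded.const (c : ℕ) : PolyBounded fun _ => c := ⟨.C c, fun k => by simp⟩

theorem PolyBounded.id : PolyBounded fun k => k := ⟨.X, fun k => by simp⟩

theorem PolyBounded.add {f g : ℕ → ℕ} (hf : PolyBounded f) (hg : PolyBounded g) :
    PolyBounded fun k => f k + g k := by
  obtain ⟨p, hp⟩ := hf
  obtain ⟨q, hq⟩ := hg
  exact ⟨p + q, fun k => by simpa using Nat.add_le_add (hp k) (hq k)⟩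

theorem PolyBounded.mul {f g : ℕ → ℕ} (hf : PolyBounded f) (hg : PolyBounded g) :
    PolyBounded fun k => f k * g k := by
  obtain ⟨p, hp⟩ := hf
  obtain ⟨q, hq⟩ := hg
  exact ⟨p * q, fun k => by simpa using Nat.mul_le_mul (hp k) (hq k)⟩

theorem PolyBounded.comp {f : ℕ → ℕ} (hf : PolyBounded f) (p : Polynomial ℕ) :
    PolyBounded fun k => p.eval (f k) := by
  obtain ⟨q, hq⟩ := hf
  exact ⟨p.comp q, fun k => by simpa using eval_mono p (hq k)⟩

theorem PolyBounded.mono {f g : ℕ → ℕ} (hf : PolyBounded f) (h : ∀ k, g k ≤ f k) :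
    PolyBounded g := by
  obtain ⟨p, hp⟩ := hf
  exact ⟨p, fun k => (h k).trans (hp k)⟩

theorem PolyBounded.slotTime {k a T Y : ℕ → ℕ} (c : ℕ) (hk : PolyBounded k) (ha : PolyBounded a)
    (hT : PolyBounded T) (hY : PolyBounded Y) :
    PolyBounded fun x => slotTime (k x) (a x) c (T x) (Y x) := by
  unfold PatternMatching.slotTime
  repeat' first | assumption | exact .id | exact .const _ | exact .eval _ |
    apply PolyBounded.add | apply PolyBounded.mul

theorem PolyBounded.serveTime {k a T Y l : ℕ → ℕ} (c m n : ℕ) (hk : PolyBounded k)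
    (ha : PolyBounded a) (hT : PolyBounded T) (hY : PolyBounded Y) (hl : PolyBounded l) :
    PolyBounded fun x => serveTime (k x) (a x) c (T x) (Y x) m (l x) n := by
  unfold PatternMatching.serveTime
  repeat' first | assumption | exact .id | exact .const _ | exact .eval _ |
    apply PolyBounded.slotTime | apply PolyBounded.add | apply PolyBounded.mul

theorem serveTime_mono {k k' a a' c T T' Y Y' m l l' n : ℕ} (hk : k ≤ k') (ha : a ≤ a')
    (hT : T ≤ T') (hY : Y ≤ Y') (hl : l ≤ l') :
    serveTime k a c T Y m l n ≤ serveTime k' a' c T' Y' m l' n := by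
  unfold serveTime slotTime
  gcongr

/-! ## The reduction -/

/-- The adversary `B` is fixed before the oracle, so the same `B` serves the real and the ideal
experiment. It is polynomial-time because `A` keeps its bound against every oracle with replies of
length at most `L k`, and `planOracle` is one of these whenever `O` has replies of length at most `Y
k`. -/
theorem exists_reduction {plan : List Bool → List Slot} {m n c : ℕ}
    (hn : ∀ w, (plan w).length = n) (hc : ∀ w p, some p ∈ plan w → p.1.length = c)
    {a Y L : ℕ → ℕ} (ha : PolyBounded a) (hY : PolyBounded Y)
    (hL : ∀ k, max (Y k) (n * (1 + (mtu + k + a k))) ≤ L k)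
    (A : Adversary) (hA : A.PolyTime a L) :
    ∃ B : Adversary, B.PolyTime a Y ∧ ∀ (k : ℕ) (σ : Type) (O : Oracle σ) (e : σ),
      (∀ e q, ∀ y ∈ (O e q).support, y.1.length ≤ Y k) →
        B.output k (a k) O e = A.output k (a k) (planOracle O k (a k) m plan) (false, e) := by
  set N := max 2 A.prog.bound with hN
  obtain ⟨p, hp⟩ : PolyBounded fun k => (20 * k + 20 * a k + 7) + (A.time.eval k) *
      (serveTime k (a k) c 1 (Y k) m
        (k + Y k + n * (1 + (mtu + k + a k)) + A.time.eval k) n + 5) + 1 := by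
    repeat' first | assumption | exact .id | exact .const _ | exact .eval _ | apply PolyBounded.serveTime |
      apply PolyBounded.slotTime | apply PolyBounded.add | apply PolyBounded.mul
  let B : Adversary := ⟨.seq (saveParams N) (replaceCall (handler N m plan) A.prog), p⟩
  have key : ∀ (k : ℕ) (σ : Type) (O : Oracle σ) (e : σ),
      (∀ e q, ∀ y ∈ (O e q).support, y.1.length ≤ Y k) →
        Exec O [B.prog] (B.time.eval k) (initRegs k (a k)) e
          ((outcome (planOracle O k (a k) m plan) (A.time.eval k)
            ⟨[A.prog], initRegs k (a k), (false, e)⟩).map fun x =>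
              (layout N x.1 k (a k) [] [] (flagReg x.2.1), x.2.2)) := by
    intro k σ O e hO
    -- Register `0` starts with `k` bits. This, the reply lengths and the number of steps of `A`
    -- bound the length of every query it can make.
    have hlen : (initRegs k (a k) 0).length = k := List.length_replicate
    refine Exec.mono (exec_seq_pure (exec_saveParams (le_max_left _ _) k (a k) e)
      (exec_replaceCall (k := k) (a := a k) (m := m) (by omega) hO hn hc (A.time.eval k)
      ⟨[A.prog], initRegs k (a k), (false, e)⟩ (by simp)
      (l := k + Y k + n * (1 + (mtu + k + a k)) + A.time.eval k) (by simp only [hlen]; omega)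
      (hA k _ _ _ fun e q y hy => (planOracle_length hO hn e q y hy).trans (hL k)))) (hp k)
  refine ⟨B, fun k σ O e hO => (key k σ O e hO).haltsIn, fun k σ O e hO => ?_⟩
  simp only [Adversary.output]
  rw [key k σ O e hO, outcome, PMF.map_comp, PMF.map_comp, PMF.map_comp]
  congr 1
  funext x
  simp [halted, layout_of_lt, show 0 < N by omega]

/-! ## The simulator -/

theorem silent_length : ∀ e q, ∀ y ∈ (silent e q).support, y.1.length ≤ 0 := by
  simp [silent]

/-- A simulator as an oracle; the state counts the answers. -/
noncomputable def Simulator.oracle (S : Simulator) (k : ℕ) : Oracle (Regs × ℕ) := fun t s =>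
  (S.next k t.2 t.1 s).map fun ρ => (ρ 0, (ρ, t.2 + 1))

/-- The simulator that answers each query by means of several answers of `S`. -/
def Simulator.batch (S : Simulator) (N m : ℕ) (plan : List Bool → List Slot)
    (p : Polynomial ℕ) : Simulator :=
  ⟨.seq (saveParams N) S.setup, serve N S.answer m plan, p⟩

/-- The polynomial `p` bounds the running time of `S.batch`. -/
structure BatchTime (S : Simulator) (a : ℕ → ℕ) (c m d n : ℕ) (p : Polynomial ℕ) : Prop where
  setup : ∀ k, (20 * k + 20 * a k + 7) + S.time.eval k + 1 ≤ p.eval k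
  answer : ∀ k i, serveTime k (a k) c (S.time.eval (k + n * (i + 1)))
    (c + k + S.time.eval (k + n * (i + 1))) m (d + k) n ≤ p.eval (k + i)

/-- The answer to query number `i` involves answers of `S` with indices below `n * (i + 1)`, for
which `S` is granted time polynomial in `k + n * (i + 1)`; this is again polynomial in `k + i`. -/
theorem exists_batchTime (S : Simulator) {a : ℕ → ℕ} (ha : PolyBounded a) (c m d n : ℕ) :
    ∃ p, BatchTime S a c m d n p := by
  have ha' := ha
  obtain ⟨q, hq⟩ := ha
  -- At `x = k + i` the argument `(n + 1) * x + n` is at least `k + n * (i + 1)`.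
  have hS : PolyBounded fun x => S.time.eval ((n + 1) * x + n) :=
    .comp (.add (.mul (.const _) .id) (.const _)) _
  obtain ⟨p₁, h₁⟩ : PolyBounded fun k => (20 * k + 20 * a k + 7) + S.time.eval k + 1 := by
    repeat' first | assumption | exact .id | exact .const _ | exact .eval _ |
      exact .comp (.add (.mul (.const _) .id) (.const _)) _ | apply PolyBounded.serveTime |
      apply PolyBounded.slotTime | apply PolyBounded.add | apply PolyBounded.mul
  obtain ⟨p₂, h₂⟩ : PolyBounded fun x => serveTime x (q.eval x) c
      (S.time.eval ((n + 1) * x + n)) (c + x + S.time.eval ((n + 1) * x + n)) m (d + x) n := by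
    repeat' first | assumption | exact .id | exact .const _ | exact .eval _ |
      apply PolyBounded.serveTime | apply PolyBounded.add
  refine ⟨p₁ + p₂, fun k => ?_, fun k i => ?_⟩
  · rw [Polynomial.eval_add]
    exact (h₁ k).trans (Nat.le_add_right _ _)
  · rw [Polynomial.eval_add]
    refine le_trans ?_ ((h₂ (k + i)).trans (Nat.le_add_left _ _))
    have h3 : S.time.eval (k + n * (i + 1)) ≤ S.time.eval ((n + 1) * (k + i) + n) :=
      eval_mono _ (by ring_nf; nlinarith [Nat.zero_le (n * k)])
    have h4 : a k ≤ q.eval (k + i) := (hq k).trans (eval_mono q (Nat.le_add_right _ _))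
    exact serveTime_mono (by omega) h4 h3 (by omega) (by omega)

section

variable {S : Simulator} {N m n c d : ℕ} {plan : List Bool → List Slot} {a : ℕ → ℕ}
  {p : Polynomial ℕ}

/-- Validity records that the registers are reachable, as `S` has a time bound only there, and that
`j` more answers keep the total within `I`. The latter allows one time bound, at `k + I`, for all
subqueries of a batch. -/
theorem implements_answer (hN : 0 < N) (hb : S.answer.bound ≤ N)
    (hS : S.PolyTime a fun k => c + k) (k I : ℕ) :
    Implements silent S.answer (S.oracle k) N k (a k) (c + k) (S.time.eval (k + I))
      (c + k + S.time.eval (k + I)) Prod.fst (fun _ => ())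
      fun j t => t.1 ∈ S.states k (a k) (c + k) t.2 ∧ t.2 + j ≤ I where
  exec := by
    rintro j ⟨ρ, i⟩ s act out flag ⟨hρ, hi⟩ hs
    have h1 := ((hS k).2 i ρ hρ s hs).exec.layout hN (by simpa using hb) k (a k) act out flag
    refine (h1.mono (eval_mono S.time (by simp only at hi; omega))).of_eq ?_
    simp only [outcome, Simulator.oracle, Simulator.next, PMF.map_comp, Function.comp_def,
      Function.update_eq_self]
  reply := by
    rintro j ⟨ρ, i⟩ s ⟨hρ, hi⟩ hs z hz
    obtain ⟨ρ', hρ', rfl⟩ := (PMF.mem_support_map_iff _ _ _).1 hz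
    refine ⟨?_, ⟨ρ, hρ, s, hs, hρ'⟩, by simp only at hi ⊢; omega⟩
    obtain ⟨x, hx, rfl⟩ := (PMF.mem_support_map_iff _ _ _).1 hρ'
    have h1 := runFor_length silent_length 0 _ _ x hx
    have h2 : S.time.eval (k + i) ≤ S.time.eval (k + I) :=
      eval_mono S.time (by simp only at hi; omega)
    simp only [Function.update_self, hs] at h1
    simp only
    omega
  skip := by
    rintro j t ⟨h1, h2⟩
    exact ⟨h1, by omega⟩

theorem exec_batch_setup (hN : 2 ≤ N) (hb : S.setup.bound ≤ N)
    (hS : S.PolyTime a fun k => c + k) (hp : BatchTime S a c m d n p) (k : ℕ) :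
    Exec silent [(S.batch N m plan p).setup] (p.eval k) (initRegs k (a k)) ()
      ((S.begin k (a k)).map fun ρ => (layout N ρ k (a k) [] [] [], ())) := by
  have h1 := ((hS k).1).exec.layout (N := N) (by omega) (by simpa using hb) k (a k) [] [] []
  refine ((exec_seq_pure (exec_saveParams hN k (a k) ()) h1).mono (hp.setup k)).of_eq ?_
  simp only [outcome, Simulator.begin, PMF.map_comp, Function.comp_def]

theorem batch_begin (hN : 2 ≤ N) (hb : S.setup.bound ≤ N)
    (hS : S.PolyTime a fun k => c + k) (hp : BatchTime S a c m d n p) (k : ℕ) :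
    (S.batch N m plan p).begin k (a k) =
      (S.begin k (a k)).map fun ρ => layout N ρ k (a k) [] [] [] := by
  have := exec_batch_setup (plan := plan) hN hb hS hp k
  unfold Exec at this
  rw [Simulator.begin]
  change PMF.map _ (runFor silent (p.eval k) _) = _
  rw [this, PMF.map_comp, PMF.map_comp]
  rfl

theorem exec_batch_answer (hN : 0 < N) (hb : S.answer.bound ≤ N)
    (hS : S.PolyTime a fun k => c + k) (hp : BatchTime S a c m d n p)
    (hn : ∀ w, (plan w).length = n)
    (hc : ∀ w p, some p ∈ plan w → p.1.length = c) {k i j : ℕ} (hj : j ≤ n * i) {ρ : Regs}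
    (hρ : ρ ∈ S.states k (a k) (c + k) j) {s : List Bool} (hs : s.length ≤ d + k)
    (y : List Bool) :
    Exec silent [(S.batch N m plan p).answer] (p.eval (k + i))
      (Function.update (layout N (Function.update ρ 0 y) k (a k) [] [] []) 0 s) ()
      ((runPlan (S.oracle k) (mtu + k + a k) ((plan (fit m s)).map
        (Option.map (slotDist k (fit k (s.drop m))))) (ρ, j)).map fun z =>
          (layout N (Function.update z.2.1 0 z.1) k (a k) [] [] [], ())) := by
  have h1 := implements_answer hN hb hS k (n * (i + 1))
  have h2 := exec_serve (m := m) hN h1 hn hc (t := (ρ, j))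
    ⟨hρ, by simp only; rw [Nat.mul_succ]; omega⟩ hs []
  rw [update_layout_of_lt _ _ _ _ _ _ _ hN, Function.update_idem]
  exact h2.mono (hp.answer k i)

theorem batch_next (hN : 0 < N) (hb : S.answer.bound ≤ N)
    (hS : S.PolyTime a fun k => c + k) (hp : BatchTime S a c m d n p)
    (hn : ∀ w, (plan w).length = n)
    (hc : ∀ w p, some p ∈ plan w → p.1.length = c) {k i j : ℕ} (hj : j ≤ n * i) {ρ : Regs}
    (hρ : ρ ∈ S.states k (a k) (c + k) j) {s : List Bool} (hs : s.length ≤ d + k)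
    (y : List Bool) :
    (S.batch N m plan p).next k i (layout N (Function.update ρ 0 y) k (a k) [] [] []) s =
      (runPlan (S.oracle k) (mtu + k + a k) ((plan (fit m s)).map
        (Option.map (slotDist k (fit k (s.drop m))))) (ρ, j)).map fun z =>
          layout N (Function.update z.2.1 0 z.1) k (a k) [] [] [] := by
  have := exec_batch_answer hN hb hS hp hn hc hj hρ hs y
  unfold Exec at this
  rw [Simulator.next]
  change PMF.map _ (runFor silent (p.eval (k + i)) _) = _
  rw [this, PMF.map_comp, PMF.map_comp]
  rfl

/-- A query consumes at most `n` answers of `S`, fewer if some slots are empty; hence an inequality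
and not an exact count. -/
theorem batch_valid (hN : 0 < N) (hb : S.answer.bound ≤ N)
    (hS : S.PolyTime a fun k => c + k) (hn : ∀ w, (plan w).length = n)
    (hc : ∀ w p, some p ∈ plan w → p.1.length = c) {k i j : ℕ} (hj : j ≤ n * i) {ρ : Regs}
    (hρ : ρ ∈ S.states k (a k) (c + k) j) {s : List Bool} :
    ∀ z ∈ (runPlan (S.oracle k) (mtu + k + a k) ((plan (fit m s)).map
      (Option.map (slotDist k (fit k (s.drop m))))) (ρ, j)).support,
    z.2.1 ∈ S.states k (a k) (c + k) z.2.2 ∧ z.2.2 ≤ n * (i + 1) := by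
  intro z hz
  have h1 := implements_answer hN hb hS k (n * (i + 1))
  exact runPlan_valid h1 (plan (fit m s)) (hc _) (t := (ρ, j))
    ⟨hρ, by simp only; rw [Nat.mul_succ, hn]; omega⟩ (fit_length k (s.drop m)) z hz

/-- Below `N` the registers are those of `S`, except that register `0` holds the collected output
`y` instead of the last answer of `S`. This does no harm, since register `0` is overwritten by the
next input. -/
theorem batch_states (hN : 2 ≤ N) (hb : S.setup.bound ≤ N) (hb' : S.answer.bound ≤ N)
    (hS : S.PolyTime a fun k => c + k) (hp : BatchTime S a c m d n p)
    (hn : ∀ w, (plan w).length = n) (hc : ∀ w p, some p ∈ plan w → p.1.length = c) (k i : ℕ) :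
    ∀ ρ' ∈ (S.batch N m plan p).states k (a k) (d + k) i, ∃ j ≤ n * i,
      ∃ ρ ∈ S.states k (a k) (c + k) j, ∃ y,
        ρ' = layout N (Function.update ρ 0 y) k (a k) [] [] [] := by
  induction i with
  | zero =>
    intro ρ' hρ'
    rw [Simulator.states, batch_begin hN hb hS hp] at hρ'
    obtain ⟨ρ, hρ, rfl⟩ := (PMF.mem_support_map_iff _ _ _).1 hρ'
    exact ⟨0, Nat.zero_le _, ρ, hρ, ρ 0, by rw [Function.update_eq_self]⟩
  | succ i ih =>
    rintro ρ'' ⟨ρ', hρ', s, hs, hρ''⟩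
    obtain ⟨j, hj, ρ, hρ, y, rfl⟩ := ih ρ' hρ'
    rw [batch_next (by omega) hb' hS hp hn hc hj hρ hs.le] at hρ''
    obtain ⟨z, hz, rfl⟩ := (PMF.mem_support_map_iff _ _ _).1 hρ''
    obtain ⟨h1, h2⟩ := batch_valid (by omega) hb' hS hn hc hj hρ z hz
    exact ⟨z.2.2, h2, z.2.1, h1, z.1, rfl⟩

theorem batch_polyTime (hN : 2 ≤ N) (hb : S.setup.bound ≤ N) (hb' : S.answer.bound ≤ N)
    (hS : S.PolyTime a fun k => c + k) (hp : BatchTime S a c m d n p)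
    (hn : ∀ w, (plan w).length = n) (hc : ∀ w p, some p ∈ plan w → p.1.length = c) :
    (S.batch N m plan p).PolyTime a fun k => d + k := by
  refine fun k => ⟨(exec_batch_setup hN hb hS hp k).haltsIn, fun i ρ' hρ' s hs => ?_⟩
  obtain ⟨j, hj, ρ, hρ, y, rfl⟩ := batch_states hN hb hb' hS hp hn hc k i ρ' hρ'
  exact (exec_batch_answer (by omega) hb' hS hp hn hc hj hρ hs.le y).haltsIn

end

attribute [local irreducible] mtu

/-! ## Encodings -/

theorem getD_fit {n i : ℕ} (h : i < n) (s : List Bool) :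
    (fit n s).getD i false = s.getD i false := by
  induction n generalizing i s with
  | zero => omega
  | succ n ih =>
    cases i with
    | zero => cases s <;> simp [fit]
    | succ i =>
      have := ih (i := i) (by omega) s.tail
      cases s with
      | nil => simp [fit]
      | cons b s => simpa [fit] using this

theorem readBits_fit {k off n : ℕ} (h : off + k ≤ n) (s : List Bool) :
    readBits k off (fit n s) = readBits k off s := by
  funext i
  exact getD_fit (by omega) s

theorem readNat_fit {k off n : ℕ} (h : off + k ≤ n) (s : List Bool) :
    readNat k off (fit n s) = readNat k off s := by
  rw [readNat, readBits_fit h, readNat]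

theorem ofFn_readBits (k off : ℕ) (s : List Bool) :
    List.ofFn (readBits k off s) = fit k (s.drop off) := by
  refine List.ext_getElem (by simp [fit_length]) fun i h1 h2 => ?_
  rw [fit_length] at h2
  have h3 := getD_fit h2 (s.drop off)
  rw [List.getD_eq_getElem _ _ (by rwa [fit_length])] at h3
  rw [h3]
  simp [readBits]

theorem getD_append_left {s t : List Bool} {i : ℕ} (h : i < s.length) :
    (s ++ t).getD i false = s.getD i false :=
  List.getD_append _ _ _ _ h

theorem getD_append_right {s t : List Bool} {n : ℕ} (h : s.length = n) (i : ℕ) :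
    (s ++ t).getD (n + i) false = t.getD i false := by
  subst h
  rw [List.getD_append_right _ _ _ _ (by omega), Nat.add_sub_cancel_left]

theorem readNat_append_right {s t : List Bool} {n : ℕ} (h : s.length = n) (k off : ℕ) :
    readNat k (n + off) (s ++ t) = readNat k off t := by
  unfold readNat readBits
  congr 3
  funext i
  rw [add_assoc, getD_append_right h]

theorem getD_ofFn {n i : ℕ} (f : Fin n → Bool) (h : i < n) :
    (List.ofFn f).getD i false = f ⟨i, h⟩ := by
  simp [h]

theorem writeNat_length (n a : ℕ) : (writeNat n a).length = n := by simp [writeNat]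

/-- The field consists of `a` ones followed by zeros, and `a ≤ n` ensures that none of the ones is
lost. -/
theorem readNat_writeNat {n a : ℕ} (h : a ≤ n) (s : List Bool) :
    readNat n 0 (writeNat n a ++ s) = a := by
  have h1 : writeNat n a = List.replicate a true ++ List.replicate (n - a) false := by
    refine List.ext_getElem (by simp [writeNat, h]) fun i h1 h2 => ?_
    simp only [writeNat, List.getElem_ofFn, List.getElem_append, List.length_replicate,
      List.getElem_replicate]
    split_ifs with h3 <;> simp [h3]
  rw [readNat, ofFn_readBits, List.drop_zero]
  have h2 : fit n (writeNat n a ++ s) = writeNat n a := by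
    rw [fit, List.takeD_eq_take _ (by simp [writeNat_length]), List.take_left' (writeNat_length _ _)]
  rw [h2, h1]
  simp [List.count_replicate]

theorem readNat_le (k off : ℕ) (s : List Bool) : readNat k off s ≤ k :=
  List.count_le_length.trans (by simp)

/-- A predicate vector as a string. -/
def writePred (v : Pred) : List Bool := List.ofFn fun j : Fin (9 * mtu) =>
  match v ⟨j.val / 9, by omega⟩ with
  | none => false
  | some b => if h : j.val % 9 = 0 then true else b ⟨j.val % 9 - 1, by omega⟩

theorem writePred_length (v : Pred) : (writePred v).length = 9 * mtu := by simp [writePred]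

theorem readPred_writePred (v : Pred) (s : List Bool) : readPred (writePred v ++ s) = v := by
  funext l
  have hl : 9 * l.val < 9 * mtu := by omega
  have hdiv : (⟨9 * l.val / 9, by omega⟩ : Fin mtu) = l := Fin.ext (by simp)
  have h0 : (writePred v ++ s).getD (9 * l) false = (v l).isSome := by
    rw [getD_append_left (by rwa [writePred_length]), writePred, getD_ofFn _ hl]
    simp only [hdiv]
    cases v l <;> simp
  rw [readPred, h0]
  cases hv : v l with
  | none => simp
  | some b =>
    simp only [Option.isSome_some, if_true, Option.some.injEq]
    funext i
    have hi : 9 * l.val + 1 + i.val < 9 * mtu := by omega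
    have hdiv' : (⟨(9 * l.val + 1 + i.val) / 9, by omega⟩ : Fin mtu) = l := Fin.ext (by simp; omega)
    rw [readBits, getD_append_left (by rwa [writePred_length]), writePred, getD_ofFn _ hi]
    simp only [hdiv', hv]
    rw [dif_neg (by omega)]
    exact congrArg b (Fin.ext (by simp; omega))

theorem readMsg_writePred {k : ℕ} (v : Pred) (m : Bits k) :
    readMsg k (writePred v ++ List.ofFn m) = m := by
  funext i
  rw [readMsg, readBits, getD_append_right (writePred_length v), getD_ofFn _ i.isLt]

theorem Trapdoor.write_length {pr : Primitives} {k : ℕ} (t : Trapdoor pr k) :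
    t.write.length = tdLen pr k := by
  simp [Trapdoor.write, tdLen, add_assoc]

theorem writeCipher_length {k : ℕ} (c : Cipher k) : (writeCipher c).length = mtu * k := by
  simp only [writeCipher, List.length_flatten, List.map_ofFn]
  simp [Function.comp_def]

/-! ## Padded lists -/

/-- The first `n` entries of a list, with `none` for the missing ones. -/
def padTo {β : Type*} : ℕ → List β → List (Option β)
  | 0, _ => []
  | n + 1, [] => none :: padTo n []
  | n + 1, b :: l => some b :: padTo n l

section

variable {α β : Type*}

theorem padTo_length (n : ℕ) (l : List β) : (padTo n l).length = n := by
  induction n generalizing l with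
  | zero => rfl
  | succ n ih => cases l <;> simp [padTo, ih]

theorem padTo_map (f : α → β) (n : ℕ) (l : List α) :
    padTo n (l.map f) = (padTo n l).map (Option.map f) := by
  induction n generalizing l with
  | zero => rfl
  | succ n ih =>
    cases l with
    | nil => simpa [padTo] using ih []
    | cons b l => simpa [padTo] using ih l

theorem mem_of_some_mem_padTo {n : ℕ} {l : List β} {b : β} (h : some b ∈ padTo n l) : b ∈ l := by
  induction n generalizing l with
  | zero => simp [padTo] at h
  | succ n ih =>
    cases l with
    | nil =>
      simp only [padTo, List.mem_cons, reduceCtorEq, false_or] at h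
      exact ih h
    | cons c l =>
      simp only [padTo, List.mem_cons, Option.some.injEq] at h ⊢
      exact h.imp_right ih

theorem ofFn_getElem? (n : ℕ) (l : List β) :
    List.ofFn (fun j : Fin n => l[j.val]?) = padTo n l := by
  induction n generalizing l with
  | zero => rfl
  | succ n ih =>
    cases l with
    | nil => simpa [List.ofFn_succ, padTo] using ih []
    | cons b l => simpa [List.ofFn_succ, padTo] using ih l

end

/-- The entries for one rule: one for the whole pattern at each position, and one for each filter
entry. -/
def ruleSlots {β : Type*} (positions : List ℕ) (len : ℕ) (f g h : ℕ → β) : List (Option β) :=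
  padTo mtu (positions.map f) ++ (padTo mtu (if len ≤ 3 then positions.map g else []) ++
    (padTo mtu (if len ≤ 3 then [] else positions.map g) ++
      padTo mtu (if len ≤ 3 then [] else positions.map h)))

section

variable {α β : Type*} {positions : List ℕ} {len : ℕ}

theorem ruleSlots_length (f g h : ℕ → β) : (ruleSlots positions len f g h).length = 4 * mtu := by
  simp only [ruleSlots, List.length_append, padTo_length]
  omega

theorem ruleSlots_map (φ : α → β) (f g h : ℕ → α) :
    (ruleSlots positions len f g h).map (Option.map φ) =
      ruleSlots positions len (fun i => φ (f i)) (fun i => φ (g i)) fun i => φ (h i) := by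
  unfold ruleSlots
  split_ifs <;> simp only [List.map_append, ← padTo_map, List.map_map, List.map_nil] <;> rfl

/-- Second-level entries occur only for strings of more than three bytes. The guard on `h` is needed
because for shorter strings the leaked list `posF2` is empty whatever the packet. -/
theorem ruleSlots_congr {f f' g g' h h' : ℕ → β} (hf : ∀ i ∈ positions, f i = f' i)
    (hg : ∀ i ∈ positions, g i = g' i) (hh : 3 < len → ∀ i ∈ positions, h i = h' i) :
    ruleSlots positions len f g h = ruleSlots positions len f' g' h' := by
  unfold ruleSlots
  rw [List.map_congr_left hf, List.map_congr_left hg]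
  split_ifs with hl
  · rfl
  · rw [List.map_congr_left (hh (by omega))]

theorem of_some_mem_ruleSlots {f g h : ℕ → β} {b : β}
    (hb : some b ∈ ruleSlots positions len f g h) : ∃ i, b = f i ∨ b = g i ∨ b = h i := by
  simp only [ruleSlots, List.mem_append] at hb
  have key : ∀ φ : ℕ → β, some b ∈ padTo mtu (positions.map φ) → ∃ i, b = φ i := by
    intro φ hφ
    obtain ⟨i, -, rfl⟩ := List.mem_map.1 (mem_of_some_mem_padTo hφ)
    exact ⟨i, rfl⟩
  have nil : some b ∉ padTo mtu ([] : List β) := fun h => by simpa using mem_of_some_mem_padTo h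
  rcases hb with hb | hb | hb | hb
  · exact (key f hb).imp fun i hi => .inl hi
  · split_ifs at hb
    · exact (key g hb).imp fun i hi => .inr (.inl hi)
    · exact (nil hb).elim
  · split_ifs at hb
    · exact (nil hb).elim
    · exact (key g hb).imp fun i hi => .inr (.inl hi)
  · split_ifs at hb
    · exact (nil hb).elim
    · exact (key h hb).imp fun i hi => .inr (.inr hi)

end

/-! ## Rules that are read from strings -/

section

variable {k : ℕ} (q : List Bool)

theorem mtu_pos : 0 < mtu := by
  unfold mtu
  norm_num

theorem readRule_string_length_pos : 1 ≤ (readRule k q).string.length := by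
  have := mtu_pos
  simp only [readRule, List.length_take, List.length_ofFn]
  omega

theorem readRule_string_length_le : (readRule k q).string.length ≤ mtu := by
  simp only [readRule, List.length_take, List.length_ofFn]
  omega

theorem readRule_first_pos : 1 ≤ (readRule k q).first := by
  unfold Rule.first
  split_ifs <;> omega

theorem readRule_first_le : (readRule k q).first ≤ mtu := by
  have := mtu_pos
  unfold Rule.first
  split_ifs
  · exact readNat_le _ _ _
  · omega

theorem Rule.last_le (r : Rule k) : r.last ≤ mtu := by
  unfold Rule.last
  split_ifs
  · exact min_le_right _ _
  · exact le_rfl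

/-- Hence padding to `mtu` slots loses no trapdoor. The bound uses that the string is non-empty and
that positions start from `1`. -/
theorem readRule_positions_length : (readRule k q).positions.length ≤ mtu := by
  have h1 := readRule_string_length_pos (k := k) q
  have h2 := readRule_first_pos (k := k) q
  have h3 := (readRule k q).last_le
  simp only [Rule.positions, List.length_range']
  omega

theorem mem_readRule_positions {i : ℕ} (h : i ∈ (readRule k q).positions) :
    1 ≤ i ∧ i ≤ mtu := by
  have h1 := readRule_string_length_pos (k := k) q
  have h2 := readRule_first_pos (k := k) q
  have h3 := (readRule k q).last_le
  simp only [Rule.positions, List.mem_range'_1] at h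
  omega

/-- The shape and the string of a rule are read from the first `11 * mtu` bits. -/
theorem readRule_fit (k' : ℕ) :
    (readRule k' (fit (11 * mtu) q)).string = (readRule k q).string ∧
      (readRule k' (fit (11 * mtu) q)).offset = (readRule k q).offset ∧
      (readRule k' (fit (11 * mtu) q)).depth = (readRule k q).depth := by
  refine ⟨?_, ?_, ?_⟩
  · simp only [readRule]
    rw [readNat_fit (by omega)]
    congr 2
    funext l
    rw [readBits_fit (by omega)]
  · exact readNat_fit (by omega) q
  · exact readNat_fit (by omega) q

end

noncomputable section

/-! ## The subqueries for a rule -/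

/-- The `len` positions from position `i` on (which is counted from `1`). -/
def spanBits (i len : ℕ) : Bits mtu := fun l => decide (i ≤ l.val + 1 ∧ l.val + 1 - i < len)

/-- The leakage `α` of an inserted string depends on its length and position alone, so the shape of
the rule determines it. -/
theorem support_placeAt (w : List Byte) (i : ℕ) :
    support (placeAt w i) = spanBits i w.length := by
  funext l
  simp only [support, placeAt, spanBits]
  split_ifs with h
  · rw [Bool.eq_iff_iff]
    simp [h]
  · simp [h]

/-- The subqueries of the reduction, computed from the description of the rule without action. -/
def rulePlan (w : List Bool) : List Slot :=
  ruleSlots (readRule 0 w).positions (readRule 0 w).string.length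
    (fun i => (writePred ((readRule 0 w).pattern i), .act))
    (fun i => (writePred ((readRule 0 w).level1 i), .zero))
    (fun i => (writePred ((readRule 0 w).level2 i), .zero))

/-- The subqueries of the simulator, computed from the leakage without action. -/
def leakPlan (w : List Bool) : List Slot :=
  ruleSlots
    (List.range' (readNat mtu (mtu + 0) w)
      (readNat mtu (mtu + (mtu + 0)) w + 2 - readNat mtu 0 w - readNat mtu (mtu + 0) w))
    (readNat mtu 0 w)
    (fun i => (List.ofFn (spanBits i (readNat mtu 0 w)),
      if w.getD (mtu + (mtu + (mtu + (mtu + (mtu + (i - 1)))))) false then .act else .random))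
    (fun i => (List.ofFn (spanBits i (min 2 (readNat mtu 0 w))),
      if w.getD (mtu + (mtu + (mtu + (i - 1)))) false then .zero else .random))
    (fun i => (List.ofFn (spanBits (i + 2) (min 2 (readNat mtu 0 w - 2))),
      if w.getD (mtu + (mtu + (mtu + (mtu + (i - 1))))) false then .zero else .random))

/-- The SHVE+ queries for a rule. -/
def ruleQueries (k : ℕ) (q : List Bool) : List (Option (List Bool)) :=
  ruleSlots (readRule k q).positions (readRule k q).string.length
    (fun i => writePred ((readRule k q).pattern i) ++ List.ofFn (readRule k q).act)
    (fun i => writePred ((readRule k q).level1 i) ++ List.ofFn (zeroMsg k))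
    (fun i => writePred ((readRule k q).level2 i) ++ List.ofFn (zeroMsg k))

theorem rulePlan_length (w : List Bool) : (rulePlan w).length = 4 * mtu := ruleSlots_length _ _ _

theorem leakPlan_length (w : List Bool) : (leakPlan w).length = 4 * mtu := ruleSlots_length _ _ _

theorem rulePlan_prefix (w : List Bool) (p : List Bool × Tail) (hp : some p ∈ rulePlan w) :
    p.1.length = 9 * mtu := by
  obtain ⟨i, h | h | h⟩ := of_some_mem_ruleSlots hp <;> subst h <;> exact writePred_length _

theorem leakPlan_prefix (w : List Bool) (p : List Bool × Tail) (hp : some p ∈ leakPlan w) :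
    p.1.length = mtu := by
  obtain ⟨i, h | h | h⟩ := of_some_mem_ruleSlots hp <;> subst h <;> exact List.length_ofFn

theorem ofFn_zeroMsg (k : ℕ) : List.ofFn (zeroMsg k) = List.replicate k false := by
  unfold zeroMsg
  simp

/-- String, offset and depth lie in the first `11 * mtu` bits and do not involve `k`, so the plan
may read them at security parameter `0`. The action is the next `k` bits and enters through
`Tail.act`. -/
theorem rulePlan_eq (k : ℕ) (q : List Bool) :
    (rulePlan (fit (11 * mtu) q)).map
        (Option.map (slotDist k (fit k (q.drop (11 * mtu))))) =
      (ruleQueries k q).map (Option.map PMF.pure) := by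
  obtain ⟨h1, h2, h3⟩ := readRule_fit (k := k) q 0
  have hpos : (readRule 0 (fit (11 * mtu) q)).positions = (readRule k q).positions := by
    simp only [Rule.positions, Rule.first, Rule.last, h1, h2, h3]
  have hact : fit k (q.drop (11 * mtu)) = List.ofFn (readRule k q).act :=
    (ofFn_readBits k (11 * mtu) q).symm
  rw [rulePlan, ruleQueries, ruleSlots_map, ruleSlots_map, hpos, hact, h1]
  refine ruleSlots_congr (fun i _ => ?_) (fun i _ => ?_) fun _ i _ => ?_
  · simp only [slotDist, Tail.dist, PMF.pure_map, Rule.pattern, h1]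
  · simp only [slotDist, Tail.dist, PMF.pure_map, Rule.level1, h1, ofFn_zeroMsg]
  · simp only [slotDist, Tail.dist, PMF.pure_map, Rule.level2, h1, ofFn_zeroMsg]

variable {pr : Primitives} {k : ℕ}

theorem shvePlus_leak (xs : List Bool) (v : Pred) (m : Bits k) :
    (shvePlusExperiment pr k).leak xs (writePred v ++ List.ofFn m) =
      (betaPlus k v m (readPayload xs)).map fun b => List.ofFn (support v) ++ List.ofFn b := by
  simp only [shvePlusExperiment, readPred_writePred, readMsg_writePred]

/-- Upon a match `betaPlus` is the message, which `tl` has to supply; otherwise it is uniform, and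
`Tail.random` samples it. -/
theorem slotDist_eq_leak (xs : List Bool) {v : Pred} {m : Bits k} {b : Bool} {act : List Bool}
    {s : Bits mtu} {tl : Tail} (hs : s = support v)
    (hb : b = decide (Matches v (readPayload xs)))
    (htl : Matches v (readPayload xs) → tl.dist k act = PMF.pure (List.ofFn m)) :
    slotDist k act (List.ofFn s, if b then tl else .random) =
      (shvePlusExperiment pr k).leak xs (writePred v ++ List.ofFn m) := by
  rw [shvePlus_leak, betaPlus, hs, hb, slotDist]
  by_cases h : Matches v (readPayload xs)
  · rw [if_pos h, if_pos (decide_eq_true h), htl h, PMF.pure_map, PMF.pure_map]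
  · rw [if_neg h, if_neg (by rwa [decide_eq_true_iff]), Tail.dist, PMF.map_comp]
    rfl

theorem writePositions_length (l : List ℕ) : (writePositions l).length = mtu := by
  simp [writePositions]

theorem getD_writePositions {i : ℕ} (h1 : 1 ≤ i) (h2 : i ≤ mtu) (l : List ℕ) (s : List Bool) :
    (writePositions l ++ s).getD (i - 1) false = decide (i ∈ l) := by
  rw [getD_append_left (by rw [writePositions_length]; omega), writePositions,
    getD_ofFn _ (by omega : i - 1 < mtu)]
  simp only [Nat.sub_add_cancel h1]

theorem Leakage.write_length (L : Leakage k) : L.write.length = 6 * mtu + (1 + k) := by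
  unfold Leakage.write
  cases L.act <;> simp only [List.length_append, writeNat_length, writePositions_length,
    List.length_replicate, List.length_cons, List.length_ofFn] <;> omega

/-- This is the security argument proper: the simulator's inputs to its subroutine have exactly the
law of the SHVE+ leakages of the rule's queries. The match bits are read from `posE`, `posF1` and
`posF2` for patterns, first and second level respectively. -/
theorem leakPlan_eq (xs q : List Bool) :
    (leakPlan (fit (6 * mtu + 1) (leakL1 (readPayload xs) (readRule k q)).write)).map
        (Option.map (slotDist k
          (fit k ((leakL1 (readPayload xs) (readRule k q)).write.drop (6 * mtu + 1))))) =
      (ruleQueries k q).map (Option.map ((shvePlusExperiment pr k).leak xs)) := by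
  set r := readRule k q with hr
  set L := leakL1 (readPayload xs) r with hL
  obtain ⟨u, hu, hw⟩ : ∃ u, u = (match L.act with
      | none => List.replicate (1 + k) false
      | some m => true :: List.ofFn m) ∧
    L.write = writeNat mtu r.string.length ++ (writeNat mtu r.first ++ (writeNat mtu r.last ++
      (writePositions L.posF1 ++ (writePositions L.posF2 ++ (writePositions L.posE ++ u))))) :=
    ⟨_, rfl, by simp only [Leakage.write, List.append_assoc]; rfl⟩
  have hn := writeNat_length mtu
  have hp := writePositions_length
  have h1 : readNat mtu 0 (fit (6 * mtu + 1) L.write) = r.string.length := by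
    rw [readNat_fit (by omega), hw, readNat_writeNat (readRule_string_length_le q)]
  have h2 : readNat mtu (mtu + 0) (fit (6 * mtu + 1) L.write) = r.first := by
    rw [readNat_fit (by omega), hw, readNat_append_right (hn _),
      readNat_writeNat (readRule_first_le q)]
  have h3 : readNat mtu (mtu + (mtu + 0)) (fit (6 * mtu + 1) L.write) = r.last := by
    rw [readNat_fit (by omega), hw, readNat_append_right (hn _), readNat_append_right (hn _),
      readNat_writeNat r.last_le]
  -- Six fields of `mtu` bits and the presence bit of the action precede the action itself.
  have h4 : L.write.drop (6 * mtu + 1) = u.tail := by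
    have : L.write.length = 6 * mtu + u.length := by
      rw [hw]; simp only [List.length_append, hn, hp]; ring
    rw [← List.drop_one, ← List.drop_drop]
    congr 1
    rw [hw]
    simp only [← List.append_assoc]
    refine List.drop_left' ?_
    simp only [List.length_append, hn, hp]
    ring
  have hpos : List.range' r.first (r.last + 2 - r.string.length - r.first) = r.positions := rfl
  rw [leakPlan, ruleQueries, ruleSlots_map, ruleSlots_map, h1, h2, h3, h4, ← hr, hpos]
  refine ruleSlots_congr (fun i hi => ?_) (fun i hi => ?_) fun hlen i hi => ?_
  · obtain ⟨hi1, hi2⟩ := mem_readRule_positions q hi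
    refine slotDist_eq_leak xs (support_placeAt _ _).symm ?_ fun hm => ?_
    · rw [getD_fit (by omega), hw, getD_append_right (hn _), getD_append_right (hn _),
        getD_append_right (hn _), getD_append_right (hp _), getD_append_right (hp _),
        getD_writePositions hi1 hi2]
      simp [hL, leakL1, List.mem_filter, hi]
    · have hact : L.act = some r.act := if_pos ⟨i, hi, hm⟩
      rw [hact] at hu
      rw [hu, List.tail_cons, fit_of_length (by simp)]
      rfl
  · obtain ⟨hi1, hi2⟩ := mem_readRule_positions q hi
    refine slotDist_eq_leak xs ?_ ?_ fun hm => ?_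
    · rw [Rule.level1, support_placeAt, List.length_take]
    · rw [getD_fit (by omega), hw, getD_append_right (hn _), getD_append_right (hn _),
        getD_append_right (hn _), getD_writePositions hi1 hi2]
      simp [hL, leakL1, List.mem_filter, hi]
    · rw [ofFn_zeroMsg]
      rfl
  · obtain ⟨hi1, hi2⟩ := mem_readRule_positions q hi
    refine slotDist_eq_leak xs ?_ ?_ fun hm => ?_
    · rw [Rule.level2, support_placeAt, List.length_take, List.length_drop]
    · rw [getD_fit (by omega), hw, getD_append_right (hn _), getD_append_right (hn _),
        getD_append_right (hn _), getD_append_right (hp _), getD_writePositions hi1 hi2]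
      simp [hL, leakL1, List.mem_filter, hi, hlen.not_ge]
    · rw [ofFn_zeroMsg]
      rfl

/-! ## The real experiment -/

/-- The encoding of a trapdoor or of its absence. -/
def slotString : Option (Trapdoor pr k) → List Bool
  | none => List.replicate (1 + tdLen pr k) false
  | some t => true :: t.write

theorem writeTrapdoors_eq (ts : List (Trapdoor pr k)) :
    writeTrapdoors ts = ((padTo mtu ts).map slotString).flatten := by
  rw [← ofFn_getElem?, List.map_ofFn, writeTrapdoors]
  congr 2

/-- The real answers to a list of queries. -/
def genSlots (κ : Bits k) (L : List (Option (List Bool))) : PMF (List (Option (Trapdoor pr k))) :=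
  L.mapM fun o => match o with
    | none => PMF.pure none
    | some q => (shvePlusKeyGen pr k κ (readPred q) (readMsg k q)).map some

theorem pmf_mapM_cons {α β : Type} (f : α → PMF β) (a : α) (l : List α) :
    (a :: l).mapM f = (f a).bind fun b => (l.mapM f).map fun bs => b :: bs := by
  rw [List.mapM_cons]
  rfl

theorem pmf_mapM_nil {α β : Type} (f : α → PMF β) : ([] : List α).mapM f = PMF.pure [] := rfl

/-- The oracle of the real SHVE+ experiment. -/
def shvePlusOracle (pr : Primitives) (k : ℕ) : Oracle (Bits k × Bool) :=
  (shvePlusExperiment pr k).realOracle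

/-- After the challenge the real oracle never changes its state, so given the key the answers are
independent. A trapdoor's string has exactly the slot's width, so nothing is cut or padded. -/
theorem runPlan_real (κ : Bits k) (L : List (Option (List Bool))) :
    runPlan (shvePlusOracle pr k) (mtu + k + pr.ctLen k)
        (L.map (Option.map PMF.pure)) (κ, true) =
      (genSlots κ L).map fun ts : List (Option (Trapdoor pr k)) =>
        ((ts.map slotString).flatten, (κ, true)) := by
  induction L with
  | nil => rw [genSlots, pmf_mapM_nil, PMF.pure_map]; rfl
  | cons o L ih =>
    rw [genSlots, pmf_mapM_cons, ← genSlots]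
    cases o with
    | none =>
      simp only [List.map_cons, Option.map_none, runPlan, ih, PMF.map_comp, PMF.pure_bind]
      rfl
    | some q =>
      simp only [List.map_cons, Option.map_some, runPlan, PMF.pure_bind]
      have h : shvePlusOracle pr k (κ, true) q =
          ((shvePlusKeyGen pr k κ (readPred q) (readMsg k q)).map Trapdoor.write).map
            fun y => (y, (κ, true)) := rfl
      simp only [h]
      simp only [PMF.bind_map, PMF.map_bind, PMF.map_comp, Function.comp_def]
      refine congrArg _ (funext fun t => ?_)
      rw [ih, PMF.map_comp]
      have ht : fit (mtu + k + pr.ctLen k) t.write = t.write := fit_of_length t.write_length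
      rw [ht]
      rfl

theorem genSlots_append (κ : Bits k) (L L' : List (Option (List Bool))) :
    (genSlots κ (L ++ L') : PMF (List (Option (Trapdoor pr k)))) =
      (genSlots κ L).bind fun ts => (genSlots κ L').map fun ts' => ts ++ ts' := by
  rw [genSlots, List.mapM_append]
  rfl

theorem genSlots_padTo (κ : Bits k) {n : ℕ} {l : List (List Bool)} (h : l.length ≤ n) :
    (genSlots κ (padTo n l) : PMF (List (Option (Trapdoor pr k)))) =
      (l.mapM fun q => shvePlusKeyGen pr k κ (readPred q) (readMsg k q)).map (padTo n) := by
  induction n generalizing l with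
  | zero =>
    rw [List.length_eq_zero_iff.1 (Nat.le_zero.1 h), pmf_mapM_nil, PMF.pure_map]
    rfl
  | succ n ih =>
    cases l with
    | nil =>
      rw [padTo, genSlots, pmf_mapM_cons, ← genSlots, ih (Nat.zero_le _),
        pmf_mapM_nil, PMF.pure_map, PMF.pure_bind, PMF.pure_map, PMF.pure_map]
      rfl
    | cons q l =>
      rw [padTo, genSlots, pmf_mapM_cons, ← genSlots, ih (by simpa using h), pmf_mapM_cons]
      simp [PMF.bind_map, PMF.map_bind, PMF.map_comp, Function.comp_def, padTo]

/-- The protocol generates both filter levels together at each position, the slots list one level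
after the other. As the trapdoors are independent, the order of sampling can be exchanged. -/
theorem pmf_mapM_pair {α β γ : Type} (f : α → PMF β) (g : α → PMF γ) (l : List α) :
    (l.mapM fun a => (f a).bind fun b => (g a).map fun c => (b, c)).map
        (fun ps => (ps.map Prod.fst, ps.map Prod.snd)) =
      (l.mapM f).bind fun bs => (l.mapM g).map fun cs => (bs, cs) := by
  induction l with
  | nil => rw [pmf_mapM_nil, pmf_mapM_nil, pmf_mapM_nil, PMF.pure_map, PMF.pure_bind, PMF.pure_map]; rfl
  | cons a l ih =>
    have h := congrArg (fun μ : PMF (List β × List γ) => (f a).bind fun b => (g a).bind fun c =>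
      μ.map fun p => (b :: p.1, c :: p.2)) ih
    simp only [pmf_mapM_cons, PMF.bind_map, PMF.map_bind, PMF.map_comp, PMF.bind_bind,
      Function.comp_def] at h ⊢
    refine h.trans (congrArg _ (funext fun b => ?_))
    rw [PMF.bind_comm]

theorem pmf_mapM_map {α β γ : Type} (f : β → PMF γ) (g : α → β) (l : List α) :
    (l.map g).mapM f = l.mapM fun a => f (g a) := by
  induction l with
  | nil => rfl
  | cons a l ih => rw [List.map_cons, pmf_mapM_cons, pmf_mapM_cons, ih]

theorem generate_singleton (κ : Bits k) (r : Rule k) :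
    generate pr k κ [r] =
      r.positions.mapM fun i => shvePlusKeyGen pr k κ (r.pattern i) r.act := by
  change PMF.bind (List.mapM _ [r]) _ = _
  rw [pmf_mapM_cons, pmf_mapM_nil]
  simp only [PMF.pure_map, PMF.bind_bind, PMF.pure_bind, List.flatten_cons, List.flatten_nil,
    List.append_nil]
  exact PMF.bind_pure _

theorem filterGenerate_singleton (κ : Bits k) (r : Rule k) :
    filterGenerate pr k κ [r] = ruleFilter pr k κ r := by
  change PMF.bind (List.mapM _ [r]) _ = _
  rw [pmf_mapM_cons, pmf_mapM_nil]
  simp only [PMF.pure_map, PMF.bind_bind, PMF.pure_bind, List.map_cons, List.map_nil,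
    List.flatten_cons, List.flatten_nil, List.append_nil]
  exact PMF.bind_pure _

theorem protocol_answer (κ : Bits k) (q : List Bool) :
    (protocolExperiment pr k).answer κ q =
      (genSlots κ (ruleQueries k q)).map fun ts : List (Option (Trapdoor pr k)) =>
        (ts.map slotString).flatten := by
  change (generate pr k κ [readRule k q]).bind (fun E =>
    (filterGenerate pr k κ [readRule k q]).bind fun F => PMF.pure
      (writeTrapdoors E ++ writeTrapdoors F.F1 ++ writeTrapdoors F.F2 ++ writeTrapdoors F.F3)) = _
  have hlen := readRule_positions_length (k := k) q
  rw [generate_singleton, filterGenerate_singleton, ruleQueries, ruleSlots, genSlots_append,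
    genSlots_padTo κ (by simpa using hlen), pmf_mapM_map]
  simp only [readPred_writePred, readMsg_writePred, PMF.bind_map, PMF.map_bind, PMF.map_comp,
    Function.comp_def]
  refine congrArg _ (funext fun E => ?_)
  rw [genSlots_append, genSlots_append, ruleFilter]
  have hnil : (genSlots κ (padTo mtu []) : PMF (List (Option (Trapdoor pr k)))) =
      PMF.pure (padTo mtu []) := by
    rw [genSlots_padTo κ (Nat.zero_le _), pmf_mapM_nil, PMF.pure_map]
  split_ifs with h
  · rw [genSlots_padTo κ (by simpa using hlen), pmf_mapM_map, hnil]
    simp only [readPred_writePred, readMsg_writePred]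
    change PMF.bind (PMF.bind _ fun ts => PMF.pure _) _ = _
    simp only [PMF.bind_bind, PMF.pure_bind, PMF.bind_map, PMF.map_bind, PMF.pure_map,
      Function.comp_def, writeTrapdoors_eq, List.map_append, List.flatten_append,
      List.append_assoc]
    rfl
  · rw [hnil, genSlots_padTo κ (by simpa using hlen), pmf_mapM_map,
      genSlots_padTo κ (by simpa using hlen), pmf_mapM_map]
    simp only [readPred_writePred, readMsg_writePred]
    have hpair := pmf_mapM_pair (fun i => shveKeyGen pr k κ ((readRule k q).level1 i))
      (fun i => shveKeyGen pr k κ ((readRule k q).level2 i)) (readRule k q).positions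
    -- The exchange is transported to the encoded reply, whose block for the filter `F1` is empty in
    -- this case.
    replace hpair := congrArg (PMF.map fun p : List (Trapdoor pr k) × List (Trapdoor pr k) =>
      writeTrapdoors E ++ writeTrapdoors (pr := pr) (k := k) [] ++ writeTrapdoors p.1 ++ writeTrapdoors p.2) hpair
    change PMF.bind (PMF.bind _ fun ts => PMF.pure _) _ = _
    simp only [PMF.bind_bind, PMF.pure_bind, PMF.bind_map, PMF.map_bind, PMF.map_comp,
      Function.comp_def, writeTrapdoors_eq, List.map_append, List.flatten_append,
      List.append_assoc] at hpair ⊢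
    exact hpair

end

/-! ## Equality of the experiments -/

/-- Putting queries to the ideal oracle amounts to running the simulator on leakages sampled for
these queries. The ideal oracle already fits replies to the slot width, so fitting them again
changes nothing. -/
theorem runPlan_ideal (G : Experiment) (S : Simulator) (k a : ℕ) (xs : List Bool)
    (L : List (Option (List Bool))) (ρ : Regs) (i : ℕ) :
    runPlan (G.idealOracle S k a) G.ansLen (L.map (Option.map PMF.pure)) (some (xs, ρ, i)) =
      (runPlan (S.oracle k) G.ansLen (L.map (Option.map (G.leak xs))) (ρ, i)).map
        fun z => (z.1, some (xs, z.2.1, z.2.2)) := by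
  induction L generalizing ρ i with
  | nil => simp [runPlan, PMF.pure_map]
  | cons o L ih =>
    cases o with
    | none =>
      simp only [List.map_cons, Option.map_none, runPlan, ih, PMF.map_comp]
      rfl
    | some q =>
      simp only [List.map_cons, Option.map_some, runPlan, PMF.pure_bind, Experiment.idealOracle,
        Simulator.oracle, PMF.bind_bind, PMF.map_bind, PMF.bind_map, Function.comp_def, ih,
        PMF.map_comp, fit_fit]

variable {pr : Primitives} {k : ℕ}

/-- The oracle of the real experiment for the protocol. -/
noncomputable def protocolOracle (pr : Primitives) (k : ℕ) : Oracle (Bits k × Bool) :=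
  (protocolExperiment pr k).realOracle

theorem planOracle_real (κ : Bits k) (f : Bool) (q : List Bool) :
    planOracle (shvePlusOracle pr k) k (pr.ctLen k) (11 * mtu) rulePlan (f, (κ, f)) q =
      (protocolOracle pr k (κ, f) q).map fun y => (y.1, (y.2.2, y.2)) := by
  cases f with
  | false =>
    have h : shvePlusOracle pr k (κ, false) q =
        PMF.pure (writeCipher (shveEnc pr k κ (readPayload q)), (κ, true)) := rfl
    have h' : protocolOracle pr k (κ, false) q =
        PMF.pure (writeCipher (shveEnc pr k κ (readPayload q)), (κ, true)) := rfl
    simp only [planOracle]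
    rw [h, h', PMF.pure_map, PMF.pure_map]
  | true =>
    have h : protocolOracle pr k (κ, true) q =
        ((protocolExperiment pr k).answer κ q).map fun y => (y, (κ, true)) := rfl
    simp only [planOracle]
    rw [h, rulePlan_eq, runPlan_real, protocol_answer, PMF.map_comp, PMF.map_comp, PMF.map_comp]
    rfl

/-- The composed oracle stores the flag for the challenge twice; identifying the two copies gives
the coupling with the protocol's oracle. -/
theorem real_eq (A B : Adversary)
    (h : ∀ κ : Bits k, B.output k (pr.ctLen k) (shvePlusOracle pr k) (κ, false) =
      A.output k (pr.ctLen k) (planOracle (shvePlusOracle pr k) k (pr.ctLen k) (11 * mtu) rulePlan)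
        (false, (κ, false))) :
    (shvePlusExperiment pr k).real B k (pr.ctLen k) =
      (protocolExperiment pr k).real A k (pr.ctLen k) := by
  refine congrArg (PMF.bind (shveSetup k)) (funext fun κ => (h κ).trans ?_)
  refine output_congr (O' := protocolOracle pr k) (fun e e' => e = (e'.2, e')) ?_ A k _ rfl
  rintro _ ⟨κ, f⟩ rfl q
  refine ⟨(protocolOracle pr k (κ, f) q).map fun y => (y.1, (y.2.2, y.2), y.2), ?_, ?_, ?_⟩
  · rw [PMF.map_comp, planOracle_real]
    rfl
  · rw [PMF.map_comp]
    exact (PMF.map_id _).symm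
  · intro x hx
    obtain ⟨y, -, rfl⟩ := (PMF.mem_support_map_iff _ _ _).1 hx
    rfl

theorem shvePlusOracle_length (k : ℕ) : ∀ e q, ∀ y ∈ (shvePlusOracle pr k e q).support,
    y.1.length ≤ max (mtu * k) (tdLen pr k) := by
  rintro ⟨κ, f⟩ q y hy
  cases f with
  | false =>
    rw [(PMF.mem_support_pure_iff _ _).1 hy]
    exact (writeCipher_length _).le.trans (le_max_left _ _)
  | true =>
    obtain ⟨z, hz, rfl⟩ := (PMF.mem_support_map_iff _ _ _).1 hy
    obtain ⟨t, -, rfl⟩ := (PMF.mem_support_map_iff _ _ _).1 hz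
    exact t.write_length.le.trans (le_max_right _ _)

theorem idealOracle_length (G : Experiment) (S : Simulator) (k a : ℕ) :
    ∀ e q, ∀ y ∈ (G.idealOracle S k a e q).support, y.1.length ≤ max G.encLen G.ansLen := by
  intro e q y hy
  match e with
  | none =>
    obtain ⟨ρ, -, rfl⟩ := (PMF.mem_support_map_iff _ _ _).1 hy
    exact (fit_length _ _).le.trans (le_max_left _ _)
  | some (x, ρ, i) =>
    obtain ⟨l, -, hy⟩ := (PMF.mem_support_bind_iff _ _ _).1 hy
    obtain ⟨ρ, -, rfl⟩ := (PMF.mem_support_map_iff _ _ _).1 hy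
    exact (fit_length _ _).le.trans (le_max_right _ _)

theorem ideal_eq {S : Simulator} {N : ℕ} {p : Polynomial ℕ} (hN : 2 ≤ N)
    (hb : S.setup.bound ≤ N) (hb' : S.answer.bound ≤ N)
    (hS : S.PolyTime pr.ctLen fun k => mtu + k)
    (hp : BatchTime S pr.ctLen mtu (6 * mtu + 1) (6 * mtu + 1) (4 * mtu) p)
    (A B : Adversary)
    (h : B.output k (pr.ctLen k) ((shvePlusExperiment pr k).idealOracle S k (pr.ctLen k)) none =
      A.output k (pr.ctLen k) (planOracle ((shvePlusExperiment pr k).idealOracle S k (pr.ctLen k))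
        k (pr.ctLen k) (11 * mtu) rulePlan) (false, none)) :
    (shvePlusExperiment pr k).ideal S B k (pr.ctLen k) =
      (protocolExperiment pr k).ideal (S.batch N (6 * mtu + 1) leakPlan p) A k (pr.ctLen k) := by
  -- The coupling keeps the packet and the registers of `S` equal on both sides. The counters
  -- differ: `j` counts answers of `S`, `i` counts rules, and `y` is the stale output in register
  -- `0`.
  refine h.trans (output_congr (fun (e : Bool × Option (List Bool × Regs × ℕ))
    (e' : Option (List Bool × Regs × ℕ)) => (e = (false, none) ∧ e' = none) ∨
      ∃ xs ρ j y i, j ≤ 4 * mtu * i ∧ ρ ∈ S.states k (pr.ctLen k) (mtu + k) j ∧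
        e = (true, some (xs, ρ, j)) ∧
        e' = some (xs, layout N (Function.update ρ 0 y) k (pr.ctLen k) [] [] [], i))
    ?_ A k _ (.inl ⟨rfl, rfl⟩))
  rintro _ _ (⟨rfl, rfl⟩ | ⟨xs, ρ, j, y, i, hj, hρ, rfl, rfl⟩) q
  · refine ⟨(S.begin k (pr.ctLen k)).map fun ρ => (fit (mtu * k) (ρ 0), (true, some (q, ρ, 0)),
      some (q, layout N ρ k (pr.ctLen k) [] [] [], 0)), ?_, ?_, ?_⟩
    · rw [PMF.map_comp]
      simp only [planOracle, Experiment.idealOracle, PMF.map_comp]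
      rfl
    · rw [PMF.map_comp]
      simp only [Experiment.idealOracle, batch_begin hN hb hS hp, PMF.map_comp, Function.comp_def]
      congr 1
      funext ρ
      rw [layout_of_lt _ _ _ _ _ _ _ (by omega)]
      rfl
    · intro x hx
      obtain ⟨ρ, hρ, rfl⟩ := (PMF.mem_support_map_iff _ _ _).1 hx
      exact .inr ⟨q, ρ, 0, ρ 0, 0, le_rfl, hρ, rfl, by rw [Function.update_eq_self]⟩
  · set L := (leakL1 (readPayload xs) (readRule k q)).write with hL
    have hlen : L.length ≤ (6 * mtu + 1) + k := by
      rw [hL, Leakage.write_length]; omega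
    have hnext := batch_next (by omega) hb' hS hp leakPlan_length leakPlan_prefix hj hρ hlen y
    have hvalid := batch_valid (m := 6 * mtu + 1) (s := L) (by omega) hb' hS leakPlan_length leakPlan_prefix hj hρ
    rw [hL, leakPlan_eq (pr := pr), ← hL] at hnext
    rw [hL, leakPlan_eq (pr := pr)] at hvalid
    -- Both replies and both new states are functions of this one run of `S`, which therefore
    -- couples them.
    set M := runPlan (S.oracle k) (mtu + k + pr.ctLen k)
      ((ruleQueries k q).map (Option.map ((shvePlusExperiment pr k).leak xs))) (ρ, j) with hM
    refine ⟨M.map fun z => (z.1, (true, some (xs, z.2.1, z.2.2)),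
      some (xs, layout N (Function.update z.2.1 0 z.1) k (pr.ctLen k) [] [] [], i + 1)),
      ?_, ?_, ?_⟩
    · rw [PMF.map_comp]
      change PMF.map _ (runPlan _ (shvePlusExperiment pr k).ansLen _ _) = _
      rw [rulePlan_eq, runPlan_ideal, PMF.map_comp]
      rfl
    · rw [PMF.map_comp]
      change (PMF.pure L).bind _ = _
      rw [PMF.pure_bind, hnext, PMF.map_comp]
      refine pmf_map_congr fun z hz => ?_
      have hz' := runPlan_length z hz
      rw [List.length_map, ruleQueries, ruleSlots_length] at hz'
      -- The collected output has exactly the length of a protocol answer, so the fitting in the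
      -- ideal oracle leaves it intact.
      have hans : z.1.length = (protocolExperiment pr k).ansLen := by
        rw [hz', mul_assoc]; rfl
      simp only [Function.comp_apply]
      rw [layout_of_lt _ _ _ _ _ _ _ (by omega), Function.update_self, fit_of_length hans]
    · intro x hx
      obtain ⟨z, hz, rfl⟩ := (PMF.mem_support_map_iff _ _ _).1 hx
      obtain ⟨h1, h2⟩ := hvalid z hz
      exact .inr ⟨xs, z.2.1, z.2.2, z.1, i + 1, h2, h1, rfl, rfl⟩

/-- The protocol is as secure as SHVE+, whose trapdoors for the message `0` are those of SHVE. -/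
theorem protocolSecure_of_shvePlusSecure (h : SHVEPlusSecure pr) : ProtocolSecureL1 pr := by
  obtain ⟨S, hS, hsec⟩ := h
  change S.PolyTime pr.ctLen fun k => mtu + k at hS
  have ha : PolyBounded pr.ctLen := pr.ctLen_le
  -- A SHVE+ leakage is a support of `mtu` bits and a message of `k` bits; a protocol leakage has `6
  -- * mtu + 1` bits before its `k` bits of action; a rule has `4 * mtu` slots.
  obtain ⟨p, hp⟩ := exists_batchTime S ha mtu (6 * mtu + 1) (6 * mtu + 1) (4 * mtu)
  obtain ⟨N, hN, hb, hb'⟩ : ∃ N, 2 ≤ N ∧ S.setup.bound ≤ N ∧ S.answer.bound ≤ N :=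
    ⟨max 2 (max S.setup.bound S.answer.bound), by omega, by omega, by omega⟩
  refine ⟨S.batch N (6 * mtu + 1) leakPlan p, ?_, fun A hA => ?_⟩
  · have hleak : (fun k => (protocolExperiment pr k).leakLen) = fun k => 6 * mtu + 1 + k := by
      funext k
      change 6 * mtu + (1 + k) = _
      ring
    rw [hleak]
    exact batch_polyTime hN hb hb' hS hp leakPlan_length leakPlan_prefix
  · have hY : PolyBounded fun k => max (mtu * k) (tdLen pr k) := by
      refine PolyBounded.mono (f := fun k => mtu * k + (mtu + k + pr.ctLen k)) ?_ fun k =>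
        max_le (Nat.le_add_right _ _) (Nat.le_add_left _ _)
      exact .add (.mul (.const _) .id) (.add (.add (.const _) .id) ha)
    obtain ⟨B, hB, hout⟩ := exists_reduction (m := 11 * mtu) rulePlan_length rulePlan_prefix ha hY
      (L := fun k => max (protocolExperiment pr k).encLen (protocolExperiment pr k).ansLen)
      (fun k => by
        change max (max (mtu * k) (mtu + k + pr.ctLen k)) (4 * mtu * (1 + (mtu + k + pr.ctLen k))) ≤
          max (mtu * k) (4 * (mtu * (1 + (mtu + k + pr.ctLen k))))
        -- One trapdoor is no longer than a whole protocol answer, so the reply bound assumed for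
        -- `A` also covers the replies of the SHVE+ oracle.
        have h1 : mtu + k + pr.ctLen k ≤ 4 * (mtu * (1 + (mtu + k + pr.ctLen k))) := by
          nlinarith [mtu_pos, Nat.zero_le (mtu + k + pr.ctLen k)]
        rw [mul_assoc]
        omega) A hA
    have hneg := hsec B hB
    have hfun : ∀ k, (shvePlusExperiment pr k).real B k (pr.ctLen k) =
          (protocolExperiment pr k).real A k (pr.ctLen k) ∧
        (shvePlusExperiment pr k).ideal S B k (pr.ctLen k) =
          (protocolExperiment pr k).ideal (S.batch N (6 * mtu + 1) leakPlan p) A k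
            (pr.ctLen k) := fun k =>
      ⟨real_eq A B fun κ => hout k _ _ _ (shvePlusOracle_length k),
        ideal_eq hN hb hb' hS hp A B
          (hout k _ _ _ (idealOracle_length (shvePlusExperiment pr k) S k _))⟩
    simpa only [(hfun _).1, (hfun _).2] using hneg

end PatternMatching

theorem theorem3 (pr : PatternMatching.Primitives)
    (hPlus : PatternMatching.SHVEPlusSecure pr) (hSHVE : PatternMatching.SHVESecure pr) :
    PatternMatching.ProtocolSecureL1 pr :=
  PatternMatching.protocolSecure_of_shvePlusSecure hPlus
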